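/- Let $k,m\in\mathbb N$, let $U\subset\mathbb R^m$ be compact and non-empty, and let $(\Omega,\mathcal F,\mathbb P)$ be a probability space. Assume the following. (A.1) $W=(W_t)_{t\in\mathbb N}$ are $\mathbb R^{k+m}$-valued random vectors; $\mathcal F_t=\sigma(W_0,\dots,W_{t-1})$ (so $\mathcal F_0$ is trivial), $W_t$ is independent of $\mathcal F_t$, and all $W_t$ have the same law, i.e. $W$ is i.i.d. (A.2) The factor process satisfies $X_0=x_0\in\mathbb R^k$ and $X_{t+1}=G(X_t,W_t)$, where $G:\mathbb R^k\times\mathbb R^{k+m}\to\mathbb R^k$ is Borel measurable and continuous in its first variable. (A.3) For every $U$-valued $(\mathcal F_t)$-adapted process $H$ the portfolio value satisfies $V^H_0=V_0>0$, $V^H_t>0$ and $\ln (V^H_{t+1}/V^H_t)=F(X_t,H_t,W_t)$, where $F:\mathbb R^k\times U\times\mathbb R^{k+m}\to\mathbb R$ is Borel measurable and (jointly) continuous in its first two variables. (A.4) There are a continuous $\omega:\mathbb R^k\to[0,\infty)$, Borel functions $a_1,a_2:\mathbb R^{k+m}\to[0,\infty)$ and constants $b_1\in(0,1)$, $b_2>0$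 with $$\omega(G(x,w))\le a_1(w)+b_1\omega(x),\qquad |F(x,h,w)|\le a_2(w)+b_2\omega(x)$$ for all $x\in\mathbb R^k$, $h\in U$, $w\in\mathbb R^{k+m}$, and $\mu^\gamma(a_1(W_0)),\mu^\gamma(a_2(W_0))\in\mathbb R$ for every $\gamma\in\mathbb R$, where $\mu^\gamma(Z)=\frac1\gamma\ln\mathbb E[e^{\gamma Z}]$ for $\gamma\ne0$ and $\mu^0(Z)=\mathbb E[Z]$. (A.5) For every $R>0$ there are $c>0$ and a probability measure $\nu$ on $\mathbb R^k$ such that $\mathbb P[G(x,W_0)\in A]\ge c\,\nu(A)$ for all Borel $A\subset\mathbb R^k$ and all $x$ with $\omega(x)\le R$. Let $\mathcal C_\omega(\mathbb R^k)$ be the set of continuous $f:\mathbb R^k\to\mathbb R$ with $\sup_x|f(x)|/(1+\omega(x))<\infty$. For $\beta>0$ put $$\|f\|_{\beta,\omega\text{-span}}=\sup_{x,y}\frac{f(x)-f(y)}{2+\beta\omega(x)+\beta\omega(y)},\qquad \|f\|_{\omega\text{-span}}=\|f\|_{1,\omega\text{-span}},$$ and for $\gamma<0$ put $$T_\gamma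 f(x)=\inf_{h\in U}\ln\mathbb E\big[e^{\gamma F(x,h,W_0)+f(G(x,W_0))}\big].$$ Then there exist $\gamma_0<0$ and functions $\beta,L:[0,\infty)\to(0,1)$ such that for every $\gamma\in(\gamma_0,0)$: (i) $T_\gamma$ maps $\mathcal C_\omega(\mathbb R^k)$ into itself, and it is a local contraction modulo constants: for all $M\ge0$ and all $f_1,f_2\in\mathcal C_\omega(\mathbb R^k)$ with $\|f_1\|_{\omega\text{-span}}\le M$, $\|f_2\|_{\omega\text{-span}}\le M$, $$\|T_\gamma f_1-T_\gamma f_2\|_{\beta(M),\omega\text{-span}}\le L(M)\,\|f_1-f_2\|_{\beta(M),\omega\text{-span}};$$ (ii) there are $u_\gamma\in\mathcal C_\omega(\mathbb R^k)$ and $\lambda_\gamma\in\mathbb R$ solving the Bellman equation $$u_\gamma(x)+\lambda_\gamma\gamma=T_\gamma u_\gamma(x)\qquad\text{for all }x\in\mathbb R^k$$ (that is, $u_\gamma$ is a fixed point of $T_\gamma$ modulo constants), and if $u\in\mathcal C_\omega(\mathbb R^k)$, $\lambda\in\mathbb R$ is any other solution, then $\lambda=\lambda_\gamma$ and $u-u_\gamma$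 is constant. -/

import Mathlib

open MeasureTheory ProbabilityTheory
open scoped NNReal ENNReal

noncomputable section

namespace RiskSensitive

/-- The Euclidean space `ℝⁿ`. -/
abbrev Vec (n : ℕ) : Type := EuclideanSpace ℝ (Fin n)

section Probability

variable {Ω : Type*} [MeasurableSpace Ω]

/-- The `σ`-algebra `𝓕 t` generated by the noise observed strictly before time `t`, that is by
`W 0, …, W (t - 1)`; in particular `𝓕 0` is trivial. -/
@[reducible]
def pastSigma {d : ℕ} (W : ℕ → Ω → Vec d) (t : ℕ) : MeasurableSpace Ω :=
  ⨆ s : ℕ, ⨆ _ : s < t, MeasurableSpace.comap (W s) inferInstance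

/-- The extended-real expectation `E[X⁺] - E[X⁻]`. -/
def extExpectation (P : Measure Ω) (X : Ω → ℝ) : EReal :=
  ((∫⁻ ξ, ENNReal.ofReal (X ξ) ∂P : ℝ≥0∞) : EReal) -
    ((∫⁻ ξ, ENNReal.ofReal (-X ξ) ∂P : ℝ≥0∞) : EReal)

/-- `ln E[e^X]`, as an extended real number (it is `+∞` if `e^X` is not integrable). -/
def logExpMoment (P : Measure Ω) (X : Ω → ℝ) : EReal :=
  ENNReal.log (∫⁻ ξ, ENNReal.ofReal (Real.exp (X ξ)) ∂P)

/-- The entropic utility measure `μ^γ`, with values in the extended real numbers. -/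
def entropicUtility (P : Measure Ω) (γ : ℝ) (X : Ω → ℝ) : EReal :=
  if γ = 0 then extExpectation P X
  else ((1 / γ : ℝ) : EReal) * logExpMoment P (fun ξ => γ * X ξ)

/-- The noise `W` is a sequence of i.i.d. random vectors: `W t` is independent of the past
`𝓕 t = σ(W 0, …, W (t - 1))` and all the `W t` have the same law. -/
structure NoiseAssumption (P : Measure Ω) {d : ℕ} (W : ℕ → Ω → Vec d) : Prop where
  measurable : ∀ t, Measurable (W t)
  indep_past : ∀ t, Indep (MeasurableSpace.comap (W t) inferInstance) (pastSigma W t) P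
  same_law : ∀ t, P.map (W (t + 1)) = P.map (W t)

/-- The factor process starts at a point `x₀` and satisfies `X (t+1) = G (X t, W t)`, with
`G` Borel measurable and continuous in its first variable. (The Markov property of `X` is a
consequence of this and of the independence of the noise.) -/
structure FactorAssumption (P : Measure Ω) {k d : ℕ} (W : ℕ → Ω → Vec d)
    (G : Vec k → Vec d → Vec k) (x₀ : Vec k) (X : ℕ → Ω → Vec k) : Prop where
  measurable_G : Measurable (fun p : Vec k × Vec d => G p.1 p.2)
  continuous_G : ∀ w, Continuous (fun x => G x w)
  init : ∀ᵐ ξ ∂P, X 0 ξ = x₀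
  step : ∀ t, ∀ᵐ ξ ∂P, X (t + 1) ξ = G (X t ξ) (W t ξ)

/-- Admissible strategies: `U`-valued processes adapted to the filtration `𝓕`. -/
def IsAdmissible {m d : ℕ} (W : ℕ → Ω → Vec d) (U : Set (Vec m)) (H : ℕ → Ω → U) : Prop :=
  ∀ t, Measurable[pastSigma W t] (H t)

/-- The value process `V H` of any admissible strategy `H` is positive, starts at `V₀ > 0`
and has the log-returns `F (X t, H t, W t)`, where `F` is Borel measurable and continuous in its
first two variables. -/
structure PortfolioAssumption (P : Measure Ω) {k m d : ℕ} (W : ℕ → Ω → Vec d)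
    (X : ℕ → Ω → Vec k) (U : Set (Vec m)) (F : Vec k → U → Vec d → ℝ) (V₀ : ℝ)
    (V : (ℕ → Ω → U) → ℕ → Ω → ℝ) : Prop where
  measurable_F : Measurable (fun p : Vec k × U × Vec d => F p.1 p.2.1 p.2.2)
  continuous_F : ∀ w, Continuous (fun p : Vec k × U => F p.1 p.2 w)
  V₀_pos : 0 < V₀
  pos : ∀ H, IsAdmissible W U H → ∀ t, ∀ᵐ ξ ∂P, 0 < V H t ξ
  init : ∀ H, IsAdmissible W U H → ∀ᵐ ξ ∂P, V H 0 ξ = V₀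
  step : ∀ H, IsAdmissible W U H → ∀ t, ∀ᵐ ξ ∂P,
    Real.log (V H (t + 1) ξ / V H t ξ) = F (X t ξ) (H t ξ) (W t ξ)

/-- `ω` is a weight function, `G` and `F` have `ω`-growth, and the coefficients `a₁`, `a₂`
evaluated at the noise have finite entropic utility for every risk-aversion parameter. -/
structure GrowthAssumption (P : Measure Ω) {k m d : ℕ} (W : ℕ → Ω → Vec d)
    (G : Vec k → Vec d → Vec k) {U : Set (Vec m)} (F : Vec k → U → Vec d → ℝ)
    (ω : Vec k → ℝ) (a₁ a₂ : Vec d → ℝ) (b₁ b₂ : ℝ) : Prop where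
  continuous_ω : Continuous ω
  nonneg_ω : ∀ x, 0 ≤ ω x
  measurable_a₁ : Measurable a₁
  measurable_a₂ : Measurable a₂
  nonneg_a₁ : ∀ w, 0 ≤ a₁ w
  nonneg_a₂ : ∀ w, 0 ≤ a₂ w
  b₁_mem : b₁ ∈ Set.Ioo (0 : ℝ) 1
  b₂_pos : 0 < b₂
  growth_G : ∀ x w, ω (G x w) ≤ a₁ w + b₁ * ω x
  growth_F : ∀ x h w, |F x h w| ≤ a₂ w + b₂ * ω x
  finite_a₁ : ∀ γ : ℝ, ∃ r : ℝ, entropicUtility P γ (fun ξ => a₁ (W 0 ξ)) = (r : EReal)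
  finite_a₂ : ∀ γ : ℝ, ∃ r : ℝ, entropicUtility P γ (fun ξ => a₂ (W 0 ξ)) = (r : EReal)

/-- Minorization on every sublevel set `C_R = {ω ≤ R}` of the weight function. -/
def MinorizationAssumption (P : Measure Ω) {k d : ℕ} (W : ℕ → Ω → Vec d)
    (G : Vec k → Vec d → Vec k) (ω : Vec k → ℝ) : Prop :=
  ∀ R : ℝ, 0 < R → ∃ c : ℝ, 0 < c ∧ ∃ ν : Measure (Vec k), IsProbabilityMeasure ν ∧
    ∀ A : Set (Vec k), MeasurableSet A → ∀ x : Vec k, ω x ≤ R →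
      ENNReal.ofReal c * ν A ≤ P {ξ | G x (W 0 ξ) ∈ A}

/-- The Bellman operator `T_γ f (x) = inf_{h ∈ U} ln E[exp (γ F(x, h, W₀) + f (G(x, W₀)))]`, with
values in the extended real numbers. -/
def bellmanOp (P : Measure Ω) {k m d : ℕ} (W : ℕ → Ω → Vec d)
    (G : Vec k → Vec d → Vec k) {U : Set (Vec m)} (F : Vec k → U → Vec d → ℝ)
    (γ : ℝ) (f : Vec k → ℝ) (x : Vec k) : EReal :=
  ⨅ h : U, logExpMoment P (fun ξ => γ * F x h (W 0 ξ) + f (G x (W 0 ξ)))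

end Probability

/-- Membership in `C_ω(ℝᵏ)`: `f` is continuous and `sup_x |f x| / (1 + ω x) < ∞`. -/
def MemCω {k : ℕ} (ω : Vec k → ℝ) (f : Vec k → ℝ) : Prop :=
  Continuous f ∧ BddAbove (Set.range fun x => |f x| / (1 + ω x))

/-- The weighted span seminorm
`‖f‖_{β,ω-span} = sup_{x,y} (f x - f y) / (2 + β ω x + β ω y)`. The supremum is finite for every
`f ∈ C_ω(ℝᵏ)` and `β > 0`; the case `β = 1` is the `ω`-span seminorm. -/
def spanSeminorm {k : ℕ} (β : ℝ) (ω : Vec k → ℝ) (f : Vec k → ℝ) : ℝ :=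
  ⨆ p : Vec k × Vec k, (f p.1 - f p.2) / (2 + β * ω p.1 + β * ω p.2)

end RiskSensitive

end

/-!
Let `Z = γ F(x, h, W₀) + f(G(x, W₀))`, so that the Bellman operator is `f ↦ inf_h ln E[e^Z]`. By the
subgradient inequality for `Z ↦ ln E[e^Z]`, its values at `f` and at `g` differ by at most the
expectation of `(f - g)(G(x, W₀))` under a measure proportional to `e^Z P`. When the span of `f` is
at most `M`, the oscillation of `Z` is at most a multiple of `1 + ω(x) + a` with
`a = a₁(W₀) + a₂(W₀)`. Tilting by such a `Z` preserves both ingredients of Harris' theorem: the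
drift, because the relative entropy of the tilted measure grows at most linearly in `1 + ω(x)` while
`a` has all exponential moments, and the overlap of the transitions out of a sublevel set of `ω`,
because `P(B)² ≤ E[e^Z] E[e^{-Z}] Q(B)` for the tilted measure `Q`. The argument of Hairer and
Mattingly then gives one weight `1 + β ω` in which all these transitions contract. For small `|γ|`
the image of `0` has so small a span that a ball of functions modulo constants is mapped into
itself, and Picard iteration yields the solution of the Bellman equation.
-/

namespace RiskSensitive

open Filter Topology Real

section Oscillation

variable {E : Type*} {w w' f g : E → ℝ} {D D' : ℝ}

/-- The oscillation of `f` relative to the weight `w` is at most `D`. For `w = 1 + β ω` this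
says that the `(β, ω)`-span seminorm of `f` is finite and at most `D`, without the junk value of
an unbounded supremum. -/
def OscLE (w : E → ℝ) (D : ℝ) (f : E → ℝ) : Prop :=
  ∀ x y, f x - f y ≤ D * (w x + w y)

lemma oscLE_zero (hw : ∀ x, 0 ≤ w x) (hD : 0 ≤ D) : OscLE w D 0 := fun x y => by
  simpa using mul_nonneg hD (add_nonneg (hw x) (hw y))

namespace OscLE

lemma abs_sub_le (hf : OscLE w D f) (x y : E) : |f x - f y| ≤ D * (w x + w y) :=
  abs_sub_le_iff.mpr ⟨hf x y, by rw [add_comm (w x)]; exact hf y x⟩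

lemma of_abs_sub_const_le {s : ℝ} (hf : ∀ x, |f x - s| ≤ D * w x) : OscLE w D f := by
  intro x y
  have hx := (abs_le.mp (hf x)).2
  have hy := (abs_le.mp (hf y)).1
  linarith

lemma exists_center [Nonempty E] (hf : OscLE w D f) : ∃ s, ∀ x, |f x - s| ≤ D * w x := by
  have hle : ∀ x y, f x - D * w x ≤ f y + D * w y := fun x y => by linarith [hf x y]
  obtain ⟨x₀⟩ := ‹Nonempty E›
  have hbdd : BddAbove (Set.range fun x => f x - D * w x) :=
    ⟨f x₀ + D * w x₀, Set.forall_mem_range.mpr fun x => hle x x₀⟩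
  refine ⟨⨆ x, (f x - D * w x), fun x => abs_le.mpr ⟨?_, ?_⟩⟩
  · linarith [ciSup_le fun y => hle y x]
  · linarith [le_ciSup hbdd x]

lemma nonneg [Nonempty E] (hw : ∀ x, 0 < w x) (hf : OscLE w D f) : 0 ≤ D := by
  obtain ⟨x⟩ := ‹Nonempty E›
  have hx : 0 ≤ D * (w x + w x) := by linarith [hf x x]
  exact nonneg_of_mul_nonneg_left hx (add_pos (hw x) (hw x))

lemma mono (hw : ∀ x, 0 ≤ w x) (hD : D ≤ D') (hf : OscLE w D f) : OscLE w D' f := fun x y =>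
  (hf x y).trans (mul_le_mul_of_nonneg_right hD (add_nonneg (hw x) (hw y)))

lemma mono_weight (hD : 0 ≤ D) (hw : ∀ x, w x ≤ w' x) (hf : OscLE w D f) : OscLE w' D f :=
  fun x y => (hf x y).trans (mul_le_mul_of_nonneg_left (add_le_add (hw x) (hw y)) hD)

lemma one_add_mul {ω : E → ℝ} {β : ℝ} (hω : ∀ x, 0 ≤ ω x) (hβ : β ∈ Set.Ioc (0 : ℝ) 1)
    (hf : OscLE (fun x => 1 + ω x) D f) : OscLE (fun x => 1 + β * ω x) (D / β) f := by
  intro x y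
  have : Nonempty E := ⟨x⟩
  have hD : 0 ≤ D := hf.nonneg fun x => add_pos_of_pos_of_nonneg one_pos (hω x)
  have hle : D ≤ D / β := le_div_self hD hβ.1 hβ.2
  calc f x - f y ≤ D * (1 + ω x + (1 + ω y)) := hf x y
    _ = 2 * D + D / β * (β * (ω x + ω y)) := by
      rw [div_mul_eq_mul_div, mul_left_comm, mul_div_cancel_left₀ _ hβ.1.ne']
      ring
    _ ≤ D / β * (1 + β * ω x + (1 + β * ω y)) := by linarith

lemma add (hf : OscLE w D f) (hg : OscLE w D' g) : OscLE w (D + D') (f + g) := by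
  intro x y
  simp only [Pi.add_apply]
  linarith [hf x y, hg x y]

lemma sub (hf : OscLE w D f) (hg : OscLE w D' g) : OscLE w (D + D') (f - g) := by
  intro x y
  simp only [Pi.sub_apply]
  linarith [hf x y, hg y x]

lemma add_const (hf : OscLE w D f) (s : ℝ) : OscLE w D (fun x => f x + s) := by
  intro x y
  linarith [hf x y]

lemma comp {E' : Type*} (hf : OscLE w D f) (φ : E' → E) : OscLE (w ∘ φ) D (f ∘ φ) :=
  fun x y => hf (φ x) (φ y)

lemma apply_eq_of_forall_mul_le {L : ℝ} (hL : L ∈ Set.Ico (0 : ℝ) 1) (hf : OscLE w D f)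
    (h : ∀ D, OscLE w D f → OscLE w (L * D) f) (x y : E) : f x = f y := by
  have hpow : ∀ n : ℕ, OscLE w (L ^ n * D) f := by
    intro n
    induction n with
    | zero => simpa using hf
    | succ n ih => simpa only [pow_succ', mul_assoc] using h _ ih
  have hlim : Tendsto (fun n : ℕ => L ^ n * D * (w x + w y)) atTop (𝓝 0) := by
    simpa using ((tendsto_pow_atTop_nhds_zero_of_lt_one hL.1 hL.2).mul_const D).mul_const
      (w x + w y)
  have hzero : |f x - f y| ≤ 0 := ge_of_tendsto' hlim fun n => (hpow n).abs_sub_le x y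
  exact sub_eq_zero.mp (abs_nonpos_iff.mp hzero)

end OscLE

end Oscillation

section FixedPoint

variable {E : Type*} [TopologicalSpace E] {w : E → ℝ} {L C r : ℝ}

lemma continuous_of_oscLE_sub_tendsto_zero {u : E → ℝ} {v : ℕ → E → ℝ} {ε : ℕ → ℝ} {z : E}
    (hw : Continuous w) (hw0 : ∀ x, 0 ≤ w x) (hv : ∀ n, Continuous (v n))
    (hz : ∀ n, u z = v n z) (hε : Tendsto ε atTop (𝓝 0))
    (h : ∀ n, OscLE w (ε n) (u - v n)) : Continuous u := by
  refine TendstoLocallyUniformly.continuous (F := v) (p := atTop) ?_ (.of_forall hv)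
  rw [Metric.tendstoLocallyUniformly_iff]
  intro δ hδ x
  refine ⟨{y | w y < w x + 1}, (isOpen_Iio.preimage hw).mem_nhds (by simp), ?_⟩
  have hlim : Tendsto (fun n => |ε n| * (w x + 1 + w z)) atTop (𝓝 0) := by
    simpa using hε.abs.mul_const (w x + 1 + w z)
  filter_upwards [hlim.eventually_lt_const hδ] with n hn y hy
  have hdiff := (h n).abs_sub_le y z
  simp only [Pi.sub_apply, sub_eq_zero.mpr (hz n), sub_zero] at hdiff
  calc dist (u y) (v n y) ≤ ε n * (w y + w z) := hdiff
    _ ≤ |ε n| * (w x + 1 + w z) := by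
      gcongr
      exacts [add_nonneg (hw0 y) (hw0 z), le_abs_self _]
    _ < δ := hn

lemma exists_limit_of_oscLE_geometric {v : ℕ → E → ℝ} {z : E} (hw : Continuous w)
    (hw0 : ∀ x, 0 ≤ w x) (hL : L ∈ Set.Ico (0 : ℝ) 1) (hv : ∀ n, Continuous (v n))
    (hz : ∀ n, v n z = 0) (hstep : ∀ n, OscLE w (C * L ^ n) (v (n + 1) - v n)) :
    ∃ u, Continuous u ∧ (∀ x, Tendsto (fun n => v n x) atTop (𝓝 (u x))) ∧
      ∀ n, OscLE w (C * L ^ n / (1 - L)) (u - v n) := by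
  have hdist : ∀ x y n, dist (v n x - v n y) (v (n + 1) x - v (n + 1) y) ≤
      C * (w x + w y) * L ^ n := by
    intro x y n
    have h := (hstep n).abs_sub_le x y
    simp only [Pi.sub_apply] at h
    rw [Real.dist_eq, abs_sub_comm]
    convert h using 1 <;> ring_nf
  have hconv : ∀ x, ∃ l, Tendsto (fun n => v n x) atTop (𝓝 l) := fun x =>
    cauchySeq_tendsto_of_complete <| cauchySeq_of_le_geometric L _ hL.2 fun n => by
      simpa only [hz, sub_zero] using hdist x z n
  choose u hu using hconv
  have hosc : ∀ n, OscLE w (C * L ^ n / (1 - L)) (u - v n) := by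
    intro n x y
    have h := dist_le_of_le_geometric_of_tendsto L _ hL.2 (hdist x y) ((hu x).sub (hu y)) n
    rw [Real.dist_eq, abs_sub_comm] at h
    simp only [Pi.sub_apply]
    calc u x - v n x - (u y - v n y) = u x - u y - (v n x - v n y) := by ring
      _ ≤ C * (w x + w y) * L ^ n / (1 - L) := (le_abs_self _).trans h
      _ = C * L ^ n / (1 - L) * (w x + w y) := by ring
  have huz : u z = 0 := tendsto_nhds_unique (hu z) (by simp [hz])
  have hrate : Tendsto (fun n => C * L ^ n / (1 - L)) atTop (𝓝 0) := by
    simpa using ((tendsto_pow_atTop_nhds_zero_of_lt_one hL.1 hL.2).const_mul C).div_const (1 - L)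
  have hcont : Continuous u := continuous_of_oscLE_sub_tendsto_zero hw hw0 hv
    (fun n => huz.trans (hz n).symm) hrate hosc
  exact ⟨u, hcont, hu, hosc⟩

/-- `T` contracts `w`-oscillations by the factor `L` on the continuous functions of
`w₀`-oscillation at most `M`: a local contraction modulo constants. -/
def IsLocalOscContraction (w₀ : E → ℝ) (M : ℝ) (w : E → ℝ) (L : ℝ) (T : (E → ℝ) → E → ℝ) : Prop :=
  ∀ f g, Continuous f → Continuous g → OscLE w₀ M f → OscLE w₀ M g →
    ∀ D, OscLE w D (f - g) → OscLE w (L * D) (T f - T g)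

variable {T : (E → ℝ) → E → ℝ}

lemma IsLocalOscContraction.oscLE_apply {f : E → ℝ} (hT : IsLocalOscContraction w r w L T)
    (hw : ∀ x, 0 ≤ w x) (hr : 0 ≤ r) (h0 : OscLE w ((1 - L) * r) (T 0)) (hf : Continuous f)
    (hfr : OscLE w r f) : OscLE w r (T f) := by
  have h := (hT f 0 hf continuous_zero hfr (oscLE_zero hw hr) r (by rwa [sub_zero])).add h0
  rwa [sub_add_cancel, show L * r + (1 - L) * r = r by ring] at h

lemma IsLocalOscContraction.continuous_and_oscLE_iterate (hT : IsLocalOscContraction w r w L T)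
    (hw : ∀ x, 0 ≤ w x) (hr : 0 ≤ r) (hTcont : ∀ f, Continuous f → OscLE w r f → Continuous (T f))
    (h0 : OscLE w ((1 - L) * r) (T 0)) (n : ℕ) : Continuous (T^[n] 0) ∧ OscLE w r (T^[n] 0) := by
  induction n with
  | zero => exact ⟨continuous_zero, oscLE_zero hw hr⟩
  | succ n ih =>
    rw [Function.iterate_succ_apply']
    exact ⟨hTcont _ ih.1 ih.2, hT.oscLE_apply hw hr h0 ih.1 ih.2⟩

lemma IsLocalOscContraction.exists_fixedPoint {z : E} (hT : IsLocalOscContraction w r w L T)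
    (hw : Continuous w) (hw0 : ∀ x, 0 ≤ w x) (hL : L ∈ Set.Ico (0 : ℝ) 1) (hr : 0 ≤ r)
    (hTcont : ∀ f, Continuous f → OscLE w r f → Continuous (T f))
    (h0 : OscLE w ((1 - L) * r) (T 0)) (hz : ∀ f, T f z = 0) :
    ∃ u, Continuous u ∧ OscLE w r u ∧ T u = u := by
  have hball := hT.continuous_and_oscLE_iterate hw0 hr hTcont h0
  have hstep : ∀ n, OscLE w ((1 - L) * r * L ^ n) (T^[n + 1] 0 - T^[n] 0) := by
    intro n
    induction n with
    | zero => simpa using h0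
    | succ n ih =>
      have h := hT _ _ (hball _).1 (hball n).1 (hball _).2 (hball n).2 _ ih
      rwa [← Function.iterate_succ_apply' T, ← Function.iterate_succ_apply' T,
        show L * ((1 - L) * r * L ^ n) = (1 - L) * r * L ^ (n + 1) by ring] at h
  have hnorm : ∀ n, T^[n] 0 z = 0
    | 0 => rfl
    | n + 1 => by rw [Function.iterate_succ_apply', hz]
  obtain ⟨u, hu, hlim, hosc⟩ :=
    exists_limit_of_oscLE_geometric hw hw0 hL (fun n => (hball n).1) hnorm hstep
  have hrate : ∀ n, (1 - L) * r * L ^ n / (1 - L) = r * L ^ n := fun n => by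
    rw [mul_assoc, mul_div_cancel_left₀ _ (sub_pos.mpr hL.2).ne']
  simp only [hrate] at hosc
  have hur : OscLE w r u := by simpa using hosc 0
  refine ⟨u, hu, hur, funext fun x => tendsto_nhds_unique ?_
    ((hlim x).comp (tendsto_add_atTop_nat 1))⟩
  have hdiff : ∀ n, |T^[n + 1] 0 x - T u x| ≤ L * (r * L ^ n) * (w x + w z) := fun n => by
    have h := (hT u _ hu (hball n).1 hur (hball n).2 _ (hosc n)).abs_sub_le x z
    rw [← Function.iterate_succ_apply' T] at h
    rw [abs_sub_comm]
    simpa only [Pi.sub_apply, hz, hnorm (n + 1), sub_zero] using h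
  have hlim0 : Tendsto (fun n => L * (r * L ^ n) * (w x + w z)) atTop (𝓝 0) := by
    simpa using (((tendsto_pow_atTop_nhds_zero_of_lt_one hL.1 hL.2).const_mul r).const_mul
      L).mul_const (w x + w z)
  exact tendsto_iff_norm_sub_tendsto_zero.mpr
    (squeeze_zero (fun _ => norm_nonneg _) hdiff hlim0)

theorem IsLocalOscContraction.exists_fixedPoint_mod_const [Nonempty E]
    (hT : IsLocalOscContraction w r w L T) (hw : Continuous w) (hw0 : ∀ x, 0 ≤ w x)
    (hL : L ∈ Set.Ico (0 : ℝ) 1) (hr : 0 ≤ r)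
    (hTcont : ∀ f, Continuous f → OscLE w r f → Continuous (T f))
    (h0 : OscLE w ((1 - L) * r) (T 0)) :
    ∃ u c, Continuous u ∧ OscLE w r u ∧ ∀ x, T u x = u x + c := by
  obtain ⟨z⟩ := ‹Nonempty E›
  have hnorm : IsLocalOscContraction w r w L fun f x => T f x + -T f z := by
    intro f g hf hg hfr hgr D hD x y
    have h := hT f g hf hg hfr hgr D hD x y
    simp only [Pi.sub_apply] at h ⊢
    linarith
  obtain ⟨u, hu, hur, hfix⟩ := hnorm.exists_fixedPoint (z := z) hw hw0 hL hr
    (fun f hf hfr => (hTcont f hf hfr).add continuous_const) (h0.add_const _)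
    fun f => add_neg_cancel _
  exact ⟨u, T u z, hu, hur, fun x => by linarith [congrFun hfix x]⟩

lemma IsLocalOscContraction.sub_eq_of_fixedPoint_mod_const {w₀ : E → ℝ} {M D c c' : ℝ}
    {u u' : E → ℝ} (hT : IsLocalOscContraction w₀ M w L T) (hL : L ∈ Set.Ico (0 : ℝ) 1)
    (hu : Continuous u) (hu' : Continuous u') (huM : OscLE w₀ M u) (huM' : OscLE w₀ M u')
    (hD : OscLE w D (u' - u)) (hfix : ∀ x, T u x = u x + c) (hfix' : ∀ x, T u' x = u' x + c')
    (x y : E) : (u' - u) x = (u' - u) y := by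
  refine hD.apply_eq_of_forall_mul_le hL (fun D' hD' => ?_) x y
  intro x y
  have h := hT u' u hu' hu huM' huM D' hD' x y
  simp only [Pi.sub_apply, hfix, hfix'] at h ⊢
  linarith

end FixedPoint

section LogMeanExp

variable {Ω : Type*} [MeasurableSpace Ω] {P : Measure Ω} {Y Z Z' : Ω → ℝ}

/-- The entropic functional `Z ↦ ln E[e^Z]` as a real number, meaningful when `e^Z` is
integrable. -/
noncomputable def logMeanExp (P : Measure Ω) (Z : Ω → ℝ) : ℝ :=
  log (∫ ξ, exp (Z ξ) ∂P)

lemma exp_logMeanExp [NeZero P] (hZ : Integrable (fun ξ => exp (Z ξ)) P) :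
    exp (logMeanExp P Z) = ∫ ξ, exp (Z ξ) ∂P :=
  exp_log (integral_exp_pos hZ)

lemma logMeanExp_mono [NeZero P] (hZ : Integrable (fun ξ => exp (Z ξ)) P)
    (hZ' : Integrable (fun ξ => exp (Z' ξ)) P) (h : ∀ ξ, Z ξ ≤ Z' ξ) :
    logMeanExp P Z ≤ logMeanExp P Z' :=
  log_le_log (integral_exp_pos hZ) (integral_mono hZ hZ' fun ξ => exp_le_exp.mpr (h ξ))

lemma logMeanExp_add_const [NeZero P] (hZ : Integrable (fun ξ => exp (Z ξ)) P) (c : ℝ) :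
    logMeanExp P (fun ξ => Z ξ + c) = logMeanExp P Z + c := by
  simp only [logMeanExp, exp_add]
  rw [integral_mul_const, log_mul (integral_exp_pos hZ).ne' (exp_pos c).ne', log_exp]

lemma logMeanExp_tilted [NeZero P] (hZ : Integrable (fun ξ => exp (Z ξ)) P)
    (hZY : Integrable (fun ξ => exp (Z ξ + Y ξ)) P) :
    logMeanExp (P.tilted Z) Y = logMeanExp P (Z + Y) - logMeanExp P Z := by
  rw [logMeanExp, integral_exp_tilted]
  exact log_div (integral_exp_pos (f := Z + Y) hZY).ne' (integral_exp_pos hZ).ne'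

lemma integral_le_logMeanExp [IsProbabilityMeasure P] (hZ : Integrable Z P)
    (hZe : Integrable (fun ξ => exp (Z ξ)) P) : ∫ ξ, Z ξ ∂P ≤ logMeanExp P Z := by
  rw [logMeanExp, le_log_iff_exp_le (integral_exp_pos hZe)]
  exact convexOn_exp.map_integral_le continuous_exp.continuousOn isClosed_univ
    (ae_of_all _ fun _ => Set.mem_univ _) hZ hZe

lemma neg_logMeanExp_neg_le [IsProbabilityMeasure P] (hZ : Integrable Z P)
    (hZe : Integrable (fun ξ => exp (Z ξ)) P) (hZe' : Integrable (fun ξ => exp (-Z ξ)) P) :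
    -logMeanExp P (-Z) ≤ logMeanExp P Z := by
  have hneg := integral_le_logMeanExp hZ.neg hZe'
  rw [integral_neg'] at hneg
  linarith [integral_le_logMeanExp hZ hZe]

/-- The tilted measure is a subgradient of `logMeanExp` at `Z`. -/
lemma integral_tilted_le_logMeanExp_sub [NeZero P] (hZ : Integrable (fun ξ => exp (Z ξ)) P)
    (hZY : Integrable (fun ξ => exp (Z ξ + Y ξ)) P) (hY : Integrable Y (P.tilted Z)) :
    ∫ ξ, Y ξ ∂P.tilted Z ≤ logMeanExp P (Z + Y) - logMeanExp P Z := by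
  have := isProbabilityMeasure_tilted hZ
  rw [← logMeanExp_tilted hZ hZY]
  refine integral_le_logMeanExp hY ((integrable_tilted_iff hZ _).mpr ?_)
  simpa only [smul_eq_mul, ← exp_add] using hZY

lemma measureReal_tilted [NeZero P] (hZ : Integrable (fun ξ => exp (Z ξ)) P) {B : Set Ω}
    (hB : MeasurableSet B) :
    exp (logMeanExp P Z) * (P.tilted Z).real B = ∫ ξ in B, exp (Z ξ) ∂P := by
  rw [exp_logMeanExp hZ, measureReal_def, tilted_apply_eq_ofReal_integral' _ hB,
    ENNReal.toReal_ofReal (integral_nonneg fun ξ => by positivity), integral_div,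
    mul_div_cancel₀ _ (integral_exp_pos hZ).ne']

lemma sq_measureReal_le_tilted [IsProbabilityMeasure P] (hZ : Integrable (fun ξ => exp (Z ξ)) P)
    (hZ' : Integrable (fun ξ => exp (-Z ξ)) P) {B : Set Ω} (hB : MeasurableSet B) :
    P.real B ^ 2 ≤ exp (logMeanExp P Z + logMeanExp P (-Z)) * (P.tilted Z).real B := by
  set K := exp (logMeanExp P (-Z))
  have hK : 0 < K := exp_pos _
  -- AM-GM with the weight `t` that makes the Cauchy-Schwarz inequality come out.
  set t := P.real B / K
  have hpt : ∀ ξ, 2 * t ≤ exp (Z ξ) + t ^ 2 * exp (-Z ξ) := fun ξ => by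
    have hone : exp (Z ξ) * exp (-Z ξ) = 1 := by rw [← exp_add, add_neg_cancel, exp_zero]
    calc 2 * t ≤ 2 * t + exp (-Z ξ) * (exp (Z ξ) - t) ^ 2 := le_add_of_nonneg_right (by positivity)
      _ = exp (Z ξ) + t ^ 2 * exp (-Z ξ) := by linear_combination (exp (Z ξ) - 2 * t) * hone
  have hint : P.real B * (2 * t) ≤
      ∫ ξ in B, exp (Z ξ) ∂P + t ^ 2 * ∫ ξ in B, exp (-Z ξ) ∂P := by
    rw [← smul_eq_mul, ← setIntegral_const, ← integral_const_mul, ← integral_add hZ.integrableOn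
      (hZ'.integrableOn.const_mul _)]
    exact integral_mono (integrable_const _) (hZ.integrableOn.add (hZ'.integrableOn.const_mul _))
      hpt
  have hneg : ∫ ξ in B, exp (-Z ξ) ∂P ≤ K := by
    rw [show K = ∫ ξ, exp (-Z ξ) ∂P from exp_logMeanExp hZ']
    exact setIntegral_le_integral hZ' (ae_of_all _ fun ξ => (exp_pos _).le)
  have htK : t * K = P.real B := div_mul_cancel₀ _ hK.ne'
  rw [exp_add, mul_right_comm, measureReal_tilted hZ hB]
  nlinarith [mul_le_mul_of_nonneg_left hneg (sq_nonneg t)]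

end LogMeanExp

section ExponentialMoments

variable {Ω : Type*} [MeasurableSpace Ω] {P : Measure Ω} {a Y Z : Ω → ℝ} {c κ s : ℝ}

/-- `a` has finite exponential moments of all (positive and negative) orders. -/
def HasExpMoments (P : Measure Ω) (a : Ω → ℝ) : Prop :=
  ∀ s, Integrable (fun ξ => exp (s * a ξ)) P

namespace HasExpMoments

lemma aemeasurable (ha : HasExpMoments P a) : AEMeasurable a P :=
  aemeasurable_of_integrable_exp_mul zero_ne_one (ha 0) (ha 1)

lemma integrable (ha : HasExpMoments P a) : Integrable a P := by
  simpa using integrable_pow_of_integrable_exp_mul one_ne_zero (ha 1) (ha (-1)) 1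

lemma integrable_exp_of_le (ha : HasExpMoments P a) (hZ : AEMeasurable Z P)
    (h : ∀ ξ, Z ξ ≤ s + κ * a ξ) : Integrable (fun ξ => exp (Z ξ)) P := by
  refine ((ha κ).const_mul (exp s)).mono' (measurable_exp.comp_aemeasurable hZ).aestronglyMeasurable
    (ae_of_all _ fun ξ => ?_)
  rw [norm_of_nonneg (exp_pos _).le, ← exp_add]
  exact exp_le_exp.mpr (h ξ)

lemma integrable_of_abs_sub_le [IsFiniteMeasure P] (ha : HasExpMoments P a)
    (hZ : AEMeasurable Z P) (h : ∀ ξ, |Z ξ - s| ≤ κ * (c + a ξ)) : Integrable Z P := by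
  have hdom := ((integrable_const c).add ha.integrable).const_mul κ
  have hsub := hdom.mono' (hZ.sub_const s).aestronglyMeasurable (ae_of_all _ h)
  exact (hsub.add (integrable_const s)).congr (ae_of_all _ fun ξ => sub_add_cancel _ _)

lemma integrable_exp_of_abs_sub_le (ha : HasExpMoments P a) (hZ : AEMeasurable Z P)
    (h : ∀ ξ, |Z ξ - s| ≤ κ * (c + a ξ)) : Integrable (fun ξ => exp (Z ξ)) P :=
  ha.integrable_exp_of_le (s := s + κ * c) (κ := κ) hZ fun ξ => by
    linarith [(abs_le.mp (h ξ)).2]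

lemma logMeanExp_le [NeZero P] (ha : HasExpMoments P a) (hZ : AEMeasurable Z P)
    (h : ∀ ξ, Z ξ ≤ s + κ * a ξ) : logMeanExp P Z ≤ cgf a P κ + s := by
  have hcgf : cgf a P κ + s = logMeanExp P fun ξ => κ * a ξ + s :=
    (logMeanExp_add_const (ha κ) s).symm
  rw [hcgf]
  refine logMeanExp_mono (ha.integrable_exp_of_le hZ h) ?_ fun ξ => (h ξ).trans_eq (add_comm _ _)
  simpa only [exp_add] using (ha κ).mul_const _

lemma add (ha : HasExpMoments P a) (hY : HasExpMoments P Y) :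
    HasExpMoments P fun ξ => a ξ + Y ξ := by
  intro s
  refine ((ha (2 * s)).add (hY (2 * s))).mono'
    (measurable_exp.comp_aemeasurable
      ((ha.aemeasurable.add hY.aemeasurable).const_mul s)).aestronglyMeasurable
    (ae_of_all _ fun ξ => ?_)
  have hsq : ∀ t, exp (s * t) ^ 2 = exp (2 * s * t) := fun t => by rw [← exp_nat_mul]; ring_nf
  have hmul := two_mul_le_add_sq (exp (s * a ξ)) (exp (s * Y ξ))
  rw [norm_of_nonneg (exp_pos _).le, mul_add, exp_add, Pi.add_apply, ← hsq, ← hsq]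
  linarith [mul_pos (exp_pos (s * a ξ)) (exp_pos (s * Y ξ))]

lemma tilted (ha : HasExpMoments P a) (hZ : AEMeasurable Z P)
    (h : ∀ ξ, |Z ξ - s| ≤ κ * (c + a ξ)) : HasExpMoments (P.tilted Z) a := by
  intro t
  rw [integrable_tilted_iff (ha.integrable_exp_of_abs_sub_le hZ h)]
  simp only [smul_eq_mul, ← exp_add]
  refine ha.integrable_exp_of_le (s := s + κ * c) (κ := κ + t)
    (hZ.add (ha.aemeasurable.const_mul t)) fun ξ => ?_
  linarith [(abs_le.mp (h ξ)).2]

variable [IsProbabilityMeasure P]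

lemma abs_logMeanExp_sub_le (ha : HasExpMoments P a) (hZ : AEMeasurable Z P)
    (h : ∀ ξ, |Z ξ - s| ≤ κ * (c + a ξ)) : |logMeanExp P Z - s| ≤ κ * c + cgf a P κ := by
  have hneg : ∀ ξ, |(-Z) ξ - -s| ≤ κ * (c + a ξ) := fun ξ => by
    rw [Pi.neg_apply, neg_sub_neg, abs_sub_comm]
    exact h ξ
  have hupper : logMeanExp P Z ≤ cgf a P κ + (s + κ * c) :=
    ha.logMeanExp_le hZ fun ξ => by linarith [(abs_le.mp (h ξ)).2]
  have hlower : logMeanExp P (-Z) ≤ cgf a P κ + (-s + κ * c) :=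
    ha.logMeanExp_le hZ.neg fun ξ => by linarith [(abs_le.mp (hneg ξ)).2]
  have hsum := neg_logMeanExp_neg_le (ha.integrable_of_abs_sub_le hZ h)
    (ha.integrable_exp_of_abs_sub_le hZ h) (ha.integrable_exp_of_abs_sub_le hZ.neg hneg)
  exact abs_le.mpr ⟨by linarith, by linarith⟩

lemma exists_pos_add_abs_cgf_le (ha : HasExpMoments P a) {δ : ℝ} (hδ : 0 < δ) :
    ∃ ρ ∈ Set.Ioc (0 : ℝ) 1, ρ + |cgf a P ρ| ≤ δ := by
  have hcont : Continuous fun ρ => ρ + |cgf a P ρ| := continuous_id.add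
    ((continuous_mgf ha).log fun t => (mgf_pos (ha t)).ne').abs
  have hlim := hcont.tendsto 0
  simp only [cgf_zero, abs_zero, add_zero] at hlim
  have hsmall : ∀ᶠ ρ in 𝓝[>] (0 : ℝ), ρ + |cgf a P ρ| < δ :=
    (hlim.eventually_lt_const hδ).filter_mono nhdsWithin_le_nhds
  obtain ⟨ρ, hρδ, hρ⟩ := (hsmall.and (Ioc_mem_nhdsGT one_pos)).exists
  exact ⟨ρ, hρ, hρδ.le⟩

lemma mul_integral_tilted_le (ha : HasExpMoments P a) (hZ : AEMeasurable Z P)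
    (h : ∀ ξ, |Z ξ - s| ≤ κ * (c + a ξ)) (θ : ℝ) :
    θ * ∫ ξ, a ξ ∂P.tilted Z ≤ 2 * κ * c + cgf a P (κ + θ) + cgf a P κ := by
  have hsum : ∀ ξ, (Z + fun ξ => θ * a ξ) ξ ≤ (s + κ * c) + (κ + θ) * a ξ := fun ξ => by
    simp only [Pi.add_apply]
    linarith [(abs_le.mp (h ξ)).2]
  have hmeas := hZ.add (ha.aemeasurable.const_mul θ)
  have hsub := integral_tilted_le_logMeanExp_sub (ha.integrable_exp_of_abs_sub_le hZ h)
    (ha.integrable_exp_of_le hmeas hsum) ((ha.tilted hZ h).integrable.const_mul θ)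
  rw [integral_const_mul] at hsub
  linarith [ha.logMeanExp_le hmeas hsum, (abs_le.mp (ha.abs_logMeanExp_sub_le hZ h)).1]

lemma exists_integral_tilted_le (ha : HasExpMoments P a) {ε : ℝ} (hκ : 0 ≤ κ) (hε : 0 < ε) :
    ∃ C, ∀ c Z, 0 ≤ c → AEMeasurable Z P → OscLE (fun ξ => c + a ξ) κ Z →
      ∫ ξ, a ξ ∂P.tilted Z ≤ ε * c + C := by
  have := nonempty_of_isProbabilityMeasure P
  set θ := 2 * κ / ε + 1
  have hθ : 0 < θ := by positivity
  refine ⟨(cgf a P (κ + θ) + cgf a P κ) / θ, fun c Z hc hZ hosc => ?_⟩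
  obtain ⟨s, hs⟩ := hosc.exists_center
  refine le_of_mul_le_mul_left ((ha.mul_integral_tilted_le hZ hs θ).trans ?_) hθ
  have hθε : 2 * κ ≤ θ * ε := by
    rw [add_mul, div_mul_cancel₀ _ hε.ne']
    linarith
  calc 2 * κ * c + cgf a P (κ + θ) + cgf a P κ ≤
      θ * ε * c + (cgf a P (κ + θ) + cgf a P κ) := by
        linarith [mul_le_mul_of_nonneg_right hθε hc]
    _ = θ * (ε * c + (cgf a P (κ + θ) + cgf a P κ) / θ) := by field_simp

lemma sq_measureReal_le_tilted_of_oscLE (ha : HasExpMoments P a) (hZ : AEMeasurable Z P)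
    (h : OscLE (fun ξ => c + a ξ) κ Z) {B : Set Ω} (hB : MeasurableSet B) :
    P.real B ^ 2 ≤ exp (2 * (κ * c + cgf a P κ)) * (P.tilted Z).real B := by
  have := nonempty_of_isProbabilityMeasure P
  obtain ⟨s, hs⟩ := h.exists_center
  have hneg : ∀ ξ, |(-Z) ξ - -s| ≤ κ * (c + a ξ) := fun ξ => by
    rw [Pi.neg_apply, neg_sub_neg, abs_sub_comm]
    exact hs ξ
  refine (sq_measureReal_le_tilted (ha.integrable_exp_of_abs_sub_le hZ hs)
    (ha.integrable_exp_of_abs_sub_le hZ.neg hneg) hB).trans ?_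
  gcongr
  linarith [(abs_le.mp (ha.abs_logMeanExp_sub_le hZ hs)).2,
    (abs_le.mp (ha.abs_logMeanExp_sub_le hZ.neg hneg)).2]

end HasExpMoments

end ExponentialMoments

section HarrisContraction

variable {E : Type*} [MeasurableSpace E] {μ₁ μ₂ : Measure E} {α D : ℝ}

/-- The overlap of `μ₁` and `μ₂` is at least `α`. For probability measures this says that their
total variation distance is at most `1 - α`. -/
def OverlapGE (α : ℝ) (μ₁ μ₂ : Measure E) : Prop :=
  ∀ A, MeasurableSet A → α ≤ μ₁.real A + μ₂.real Aᶜ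

lemma overlapGE_zero (μ₁ μ₂ : Measure E) : OverlapGE 0 μ₁ μ₂ := fun _ _ =>
  add_nonneg measureReal_nonneg measureReal_nonneg

lemma OverlapGE.mul_le_integral_add_integral [IsFiniteMeasure μ₂] (h : OverlapGE α μ₁ μ₂)
    (hD : 0 ≤ D) {ψ₁ ψ₂ : E → ℝ} (hψ₁ : Measurable ψ₁) (hψ₁_nonneg : ∀ x, 0 ≤ ψ₁ x)
    (hψ₂_nonneg : ∀ x, 0 ≤ ψ₂ x) (hψ₁_int : Integrable ψ₁ μ₁) (hψ₂_int : Integrable ψ₂ μ₂)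
    (hψ : ∀ x, 2 * D ≤ ψ₁ x + ψ₂ x) :
    α * D ≤ ∫ x, ψ₁ x ∂μ₁ + ∫ x, ψ₂ x ∂μ₂ := by
  have hcompl : {x | D ≤ ψ₁ x}ᶜ ⊆ {x | D ≤ ψ₂ x} := fun x hx => by
    have hx' : ψ₁ x < D := not_le.mp hx
    exact show D ≤ ψ₂ x by linarith [hψ x]
  calc α * D ≤ (μ₁.real {x | D ≤ ψ₁ x} + μ₂.real {x | D ≤ ψ₁ x}ᶜ) * D :=
        mul_le_mul_of_nonneg_right (h _ (measurableSet_le measurable_const hψ₁)) hD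
    _ ≤ (μ₁.real {x | D ≤ ψ₁ x} + μ₂.real {x | D ≤ ψ₂ x}) * D := by
        gcongr
        exact measure_ne_top _ _
    _ = D * μ₁.real {x | D ≤ ψ₁ x} + D * μ₂.real {x | D ≤ ψ₂ x} := by ring
    _ ≤ ∫ x, ψ₁ x ∂μ₁ + ∫ x, ψ₂ x ∂μ₂ :=
        add_le_add (mul_meas_ge_le_integral_of_nonneg (ae_of_all _ hψ₁_nonneg) hψ₁_int D)
          (mul_meas_ge_le_integral_of_nonneg (ae_of_all _ hψ₂_nonneg) hψ₂_int D)

variable [IsProbabilityMeasure μ₁] [IsProbabilityMeasure μ₂]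

lemma OverlapGE.integral_sub_integral_le (h : OverlapGE α μ₁ μ₂) {v φ : E → ℝ}
    (hv : Measurable v) (hv_nonneg : ∀ x, 0 ≤ v x) (hv₁ : Integrable v μ₁) (hv₂ : Integrable v μ₂)
    (hφ : Measurable φ) (hosc : OscLE (fun x => 1 + v x) D φ) :
    ∫ x, φ x ∂μ₁ - ∫ x, φ x ∂μ₂ ≤ D * (2 - α + (∫ x, v x ∂μ₁ + ∫ x, v x ∂μ₂)) := by
  have := nonempty_of_isProbabilityMeasure μ₁
  have hD : 0 ≤ D := hosc.nonneg fun x => by linarith [hv_nonneg x]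
  obtain ⟨s, hs⟩ := hosc.exists_center
  have hweight : ∀ μ : Measure E, IsProbabilityMeasure μ → Integrable v μ →
      Integrable (fun x => D * (1 + v x)) μ ∧
        ∫ x, D * (1 + v x) ∂μ = D * (1 + ∫ x, v x ∂μ) := fun μ _ hvμ =>
    ⟨((integrable_const 1).add hvμ).const_mul D, by
      rw [integral_const_mul, integral_add (integrable_const 1) hvμ]
      simp⟩
  have hcentered : ∀ μ : Measure E, IsProbabilityMeasure μ → Integrable v μ →
      Integrable (fun x => φ x - s) μ ∧ ∫ x, (φ x - s) ∂μ = ∫ x, φ x ∂μ - s := fun μ _ hvμ => by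
    have hint := (hweight μ ‹_› hvμ).1.mono' (hφ.sub_const s).aestronglyMeasurable (ae_of_all _ hs)
    have hφμ : Integrable φ μ :=
      (hint.add (integrable_const s)).congr (ae_of_all _ fun x => sub_add_cancel _ _)
    exact ⟨hint, by simp [integral_sub hφμ (integrable_const s)]⟩
  obtain ⟨hw₁, hw₁_eq⟩ := hweight μ₁ ‹_› hv₁
  obtain ⟨hw₂, hw₂_eq⟩ := hweight μ₂ ‹_› hv₂
  obtain ⟨hφ₁, hφ₁_eq⟩ := hcentered μ₁ ‹_› hv₁
  obtain ⟨hφ₂, hφ₂_eq⟩ := hcentered μ₂ ‹_› hv₂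
  have hoverlap := h.mul_le_integral_add_integral hD
    (ψ₁ := fun x => D * (1 + v x) - (φ x - s)) (ψ₂ := fun x => D * (1 + v x) + (φ x - s))
    (by fun_prop) (fun x => by linarith [(abs_le.mp (hs x)).2])
    (fun x => by linarith [(abs_le.mp (hs x)).1]) (hw₁.sub hφ₁) (hw₂.add hφ₂)
    (fun x => by linarith [mul_nonneg hD (hv_nonneg x)])
  rw [integral_sub hw₁ hφ₁, integral_add hw₂ hφ₂, hw₁_eq, hw₂_eq, hφ₁_eq, hφ₂_eq] at hoverlap
  linarith

lemma exists_geometric_weight {b C R : ℝ} (hb : b < 1) (hα : 0 < α) (hR : 0 < R)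
    (hCR : 2 * C < (1 - b) * R) :
    ∃ β ∈ Set.Ioo (0 : ℝ) 1, ∃ L ∈ Set.Ioo (0 : ℝ) 1, ∀ s, 0 ≤ s →
      2 + β * (b * s + 2 * C) - (if s ≤ R then α else 0) ≤ L * (2 + β * s) := by
  set β := min (1 / 2) (α / (4 * |C| + 4))
  have hβ : 0 < β := lt_min one_half_pos (by positivity)
  have hβC : 2 * (β * C) ≤ α / 2 := by
    have h : β * (4 * |C| + 4) ≤ α := (le_div_iff₀ (by positivity)).mp (min_le_right _ _)
    linarith [mul_le_mul_of_nonneg_left (le_abs_self C) hβ.le]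
  set ε := β * ((1 - b) * R - 2 * C) / (2 + β * R)
  have hε : 0 < ε := div_pos (mul_pos hβ (sub_pos.mpr hCR)) (by positivity)
  have hεR : ε * (2 + β * R) = β * ((1 - b) * R - 2 * C) := div_mul_cancel₀ _ (by positivity)
  -- `δ` is the gain of the overlap for `s ≤ R`, and that of the drift for `R < s`.
  obtain ⟨δ, hδ, hδ_half, hδα, hδb, hδε⟩ :
      ∃ δ > 0, δ ≤ 1 / 2 ∧ δ ≤ α / 4 ∧ δ ≤ 1 - b ∧ δ ≤ ε :=
    ⟨min (min (1 / 2) (α / 4)) (min (1 - b) ε), by simp [hα, hb, hε], by simp, by simp, by simp,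
      by simp⟩
  refine ⟨β, ⟨hβ, (min_le_left _ _).trans_lt one_half_lt_one⟩, 1 - δ,
    ⟨by linarith, by linarith⟩, fun s hs => ?_⟩
  split_ifs with hsR
  · nlinarith [mul_nonneg (mul_nonneg hβ.le hs) (sub_nonneg.mpr hδb)]
  · have hslope : 0 ≤ β * (1 - b - δ) * (s - R) :=
      mul_nonneg (mul_nonneg hβ.le (by linarith)) (by linarith)
    have hgain : δ * (2 + β * R) ≤ β * ((1 - b) * R - 2 * C) :=
      (mul_le_mul_of_nonneg_right hδε (by positivity)).trans_eq hεR
    linarith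

theorem exists_contraction_of_drift_of_overlap {ω : E → ℝ} {b C R : ℝ} (hω : Measurable ω)
    (hω_nonneg : ∀ x, 0 ≤ ω x) (hb : b < 1) (hα : 0 < α) (hR : 0 < R)
    (hCR : 2 * C < (1 - b) * R) :
    ∃ β ∈ Set.Ioo (0 : ℝ) 1, ∃ L ∈ Set.Ioo (0 : ℝ) 1, ∀ (μ₁ μ₂ : Measure E) (s₁ s₂ : ℝ),
      IsProbabilityMeasure μ₁ → IsProbabilityMeasure μ₂ → 0 ≤ s₁ → 0 ≤ s₂ →
      Integrable ω μ₁ → Integrable ω μ₂ →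
      ∫ x, ω x ∂μ₁ ≤ b * s₁ + C → ∫ x, ω x ∂μ₂ ≤ b * s₂ + C →
      (s₁ + s₂ ≤ R → OverlapGE α μ₁ μ₂) →
      ∀ D φ, Measurable φ → OscLE (fun x => 1 + β * ω x) D φ →
        ∫ x, φ x ∂μ₁ - ∫ x, φ x ∂μ₂ ≤ L * D * ((1 + β * s₁) + (1 + β * s₂)) := by
  obtain ⟨β, hβ, L, hL, hβL⟩ := exists_geometric_weight hb hα hR hCR
  refine ⟨β, hβ, L, hL, fun μ₁ μ₂ s₁ s₂ _ _ hs₁ hs₂ hω₁ hω₂ hdrift₁ hdrift₂ hover D φ hφ hosc => ?_⟩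
  have := nonempty_of_isProbabilityMeasure μ₁
  have hv_nonneg : ∀ x, 0 ≤ β * ω x := fun x => mul_nonneg hβ.1.le (hω_nonneg x)
  have hD : 0 ≤ D := hosc.nonneg fun x => by linarith [hv_nonneg x]
  have hoverlap : OverlapGE (if s₁ + s₂ ≤ R then α else 0) μ₁ μ₂ := by
    split_ifs with hs
    exacts [hover hs, overlapGE_zero μ₁ μ₂]
  calc ∫ x, φ x ∂μ₁ - ∫ x, φ x ∂μ₂
      ≤ D * (2 - (if s₁ + s₂ ≤ R then α else 0) +
          (∫ x, β * ω x ∂μ₁ + ∫ x, β * ω x ∂μ₂)) :=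
        hoverlap.integral_sub_integral_le (hω.const_mul β) hv_nonneg (hω₁.const_mul β)
          (hω₂.const_mul β) hφ hosc
    _ ≤ D * (2 + β * (b * (s₁ + s₂) + 2 * C) - (if s₁ + s₂ ≤ R then α else 0)) := by
        rw [integral_const_mul, integral_const_mul]
        refine mul_le_mul_of_nonneg_left ?_ hD
        linarith [mul_le_mul_of_nonneg_left (add_le_add hdrift₁ hdrift₂) hβ.1.le]
    _ ≤ D * (L * (2 + β * (s₁ + s₂))) :=
        mul_le_mul_of_nonneg_left (hβL _ (add_nonneg hs₁ hs₂)) hD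
    _ = L * D * ((1 + β * s₁) + (1 + β * s₂)) := by ring

end HarrisContraction

section TiltedTransitions

variable {E Ω : Type*} [TopologicalSpace E] [MeasurableSpace E] [MeasurableSpace Ω]

/-- The state moves from `x` to `G x ξ` with `ξ` distributed according to `P`. The weight `ω` is a
Lyapunov function: it contracts at rate `b` up to the noise `a`, which has all exponential
moments, and the transition probabilities are minorized on its sublevel sets. -/
structure LyapunovTransition (P : Measure Ω) (G : E → Ω → E) (ω : E → ℝ) (a : Ω → ℝ) (b : ℝ) :
    Prop where
  measurable_apply : ∀ x, Measurable (G x)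
  continuous_apply : ∀ ξ, Continuous fun x => G x ξ
  continuous_weight : Continuous ω
  weight_nonneg : ∀ x, 0 ≤ ω x
  expMoments : HasExpMoments P a
  rate_lt_one : b < 1
  weight_le : ∀ x ξ, ω (G x ξ) ≤ a ξ + b * ω x
  minorization : ∀ R, 0 < R → ∃ c > 0, ∃ ν : Measure E, IsProbabilityMeasure ν ∧
    ∀ B, MeasurableSet B → ∀ x, ω x ≤ R → c * ν.real B ≤ P.real (G x ⁻¹' B)

variable {P : Measure Ω} {G : E → Ω → E} {ω : E → ℝ} {a Z : Ω → ℝ}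
  {b κ M : ℝ} {f : E → ℝ} {x : E}

namespace LyapunovTransition

lemma weight_apply_le (hG : LyapunovTransition P G ω a b) (x : E) (ξ : Ω) :
    1 + ω (G x ξ) ≤ 1 + ω x + a ξ := by
  have hb : b * ω x ≤ ω x := mul_le_of_le_one_left (hG.weight_nonneg x) hG.rate_lt_one.le
  linarith [hG.weight_le x ξ]

lemma oscLE_comp (hG : LyapunovTransition P G ω a b) (hM : 0 ≤ M)
    (hf : OscLE (fun z => 1 + ω z) M f) : OscLE (fun ξ => 1 + ω x + a ξ) M (f ∘ G x) :=
  (hf.comp (G x)).mono_weight hM (hG.weight_apply_le x)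

variable [IsProbabilityMeasure P]

lemma isProbabilityMeasure_tilted (hG : LyapunovTransition P G ω a b) (hZ : AEMeasurable Z P)
    (hosc : OscLE (fun ξ => 1 + ω x + a ξ) κ Z) : IsProbabilityMeasure (P.tilted Z) := by
  have := nonempty_of_isProbabilityMeasure P
  obtain ⟨s, hs⟩ := hosc.exists_center
  exact MeasureTheory.isProbabilityMeasure_tilted
    (hG.expMoments.integrable_exp_of_abs_sub_le hZ hs)

lemma integrable_comp_tilted (hG : LyapunovTransition P G ω a b) (hZ : AEMeasurable Z P)
    (hosc : OscLE (fun ξ => 1 + ω x + a ξ) κ Z) (hM : 0 ≤ M) (hf : Measurable f)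
    (hfM : OscLE (fun z => 1 + ω z) M f) : Integrable (fun ξ => f (G x ξ)) (P.tilted Z) := by
  have := nonempty_of_isProbabilityMeasure P
  have := hG.isProbabilityMeasure_tilted hZ hosc
  obtain ⟨s, hs⟩ := hosc.exists_center
  obtain ⟨t, ht⟩ := (hG.oscLE_comp (x := x) hM hfM).exists_center
  exact (hG.expMoments.tilted hZ hs).integrable_of_abs_sub_le
    (hf.comp (hG.measurable_apply x)).aemeasurable ht

lemma exists_tilted_overlap (hG : LyapunovTransition P G ω a b) (hκ : 0 ≤ κ) {R : ℝ}
    (hR : 0 < R) :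
    ∃ α > 0, ∀ x y Z Z', AEMeasurable Z P → AEMeasurable Z' P →
      OscLE (fun ξ => 1 + ω x + a ξ) κ Z → OscLE (fun ξ => 1 + ω y + a ξ) κ Z' →
      ω x ≤ R → ω y ≤ R → OverlapGE α ((P.tilted Z).map (G x)) ((P.tilted Z').map (G y)) := by
  obtain ⟨c, hc, ν, hν, hmin⟩ := hG.minorization R hR
  set K := exp (2 * (κ * (1 + R) + cgf a P κ))
  have hK : 0 < K := exp_pos _
  have htilted : ∀ x Z B, AEMeasurable Z P → OscLE (fun ξ => 1 + ω x + a ξ) κ Z → ω x ≤ R →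
      MeasurableSet B → (c * ν.real B) ^ 2 / K ≤ ((P.tilted Z).map (G x)).real B := by
    intro x Z B hZ hosc hx hB
    rw [map_measureReal_apply (hG.measurable_apply x) hB, div_le_iff₀' hK]
    calc (c * ν.real B) ^ 2 ≤ P.real (G x ⁻¹' B) ^ 2 :=
          pow_le_pow_left₀ (by positivity) (hmin B hB x hx) 2
      _ ≤ exp (2 * (κ * (1 + ω x) + cgf a P κ)) * (P.tilted Z).real (G x ⁻¹' B) :=
          hG.expMoments.sq_measureReal_le_tilted_of_oscLE hZ hosc (hG.measurable_apply x hB)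
      _ ≤ exp (2 * (κ * (1 + R) + cgf a P κ)) * (P.tilted Z).real (G x ⁻¹' B) := by gcongr
  refine ⟨c ^ 2 / (2 * K), by positivity, fun x y Z Z' hZ hZ' hosc hosc' hx hy B hB => ?_⟩
  have hν_compl : ν.real B + ν.real Bᶜ = 1 := by rw [probReal_compl_eq_one_sub hB]; ring
  have hsq : 1 / 2 ≤ ν.real B ^ 2 + ν.real Bᶜ ^ 2 := by
    nlinarith [sq_nonneg (ν.real B - ν.real Bᶜ)]
  calc c ^ 2 / (2 * K) = c ^ 2 / K * (1 / 2) := by ring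
    _ ≤ c ^ 2 / K * (ν.real B ^ 2 + ν.real Bᶜ ^ 2) := by gcongr
    _ = (c * ν.real B) ^ 2 / K + (c * ν.real Bᶜ) ^ 2 / K := by ring
    _ ≤ _ := add_le_add (htilted x Z B hZ hosc hx hB) (htilted y Z' Bᶜ hZ' hosc' hy hB.compl)

variable [OpensMeasurableSpace E]

lemma integrable_weight_tilted (hG : LyapunovTransition P G ω a b) (hZ : AEMeasurable Z P)
    (hosc : OscLE (fun ξ => 1 + ω x + a ξ) κ Z) :
    Integrable (fun ξ => ω (G x ξ)) (P.tilted Z) := by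
  refine hG.integrable_comp_tilted hZ hosc zero_le_one hG.continuous_weight.measurable fun y z => ?_
  linarith [hG.weight_nonneg y, hG.weight_nonneg z]

lemma exists_tilted_drift (hG : LyapunovTransition P G ω a b) (hκ : 0 ≤ κ) :
    ∃ b' < 1, ∃ C, ∀ x Z, AEMeasurable Z P → OscLE (fun ξ => 1 + ω x + a ξ) κ Z →
      ∫ ξ, ω (G x ξ) ∂P.tilted Z ≤ b' * ω x + C := by
  have hb := hG.rate_lt_one
  obtain ⟨C, hC⟩ := hG.expMoments.exists_integral_tilted_le hκ (half_pos (sub_pos.mpr hb))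
  refine ⟨b + (1 - b) / 2, by linarith, C + (1 - b) / 2, fun x Z hZ hosc => ?_⟩
  have := nonempty_of_isProbabilityMeasure P
  have := hG.isProbabilityMeasure_tilted hZ hosc
  obtain ⟨s, hs⟩ := hosc.exists_center
  have ha := (hG.expMoments.tilted hZ hs).integrable
  calc ∫ ξ, ω (G x ξ) ∂P.tilted Z ≤ ∫ ξ, (a ξ + b * ω x) ∂P.tilted Z :=
        integral_mono (hG.integrable_weight_tilted hZ hosc) (ha.add (integrable_const _))
          (hG.weight_le x)
    _ = ∫ ξ, a ξ ∂P.tilted Z + b * ω x := by rw [integral_add ha (integrable_const _)]; simp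
    _ ≤ (b + (1 - b) / 2) * ω x + (C + (1 - b) / 2) := by
        linarith [hC (1 + ω x) Z (by linarith [hG.weight_nonneg x]) hZ hosc]

theorem exists_tilted_contraction (hG : LyapunovTransition P G ω a b) (hκ : 0 ≤ κ) :
    ∃ β ∈ Set.Ioo (0 : ℝ) 1, ∃ L ∈ Set.Ioo (0 : ℝ) 1, ∀ x y Z Z', AEMeasurable Z P →
      AEMeasurable Z' P → OscLE (fun ξ => 1 + ω x + a ξ) κ Z →
      OscLE (fun ξ => 1 + ω y + a ξ) κ Z' →
      ∀ D φ, Measurable φ → OscLE (fun z => 1 + β * ω z) D φ →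
        ∫ ξ, φ (G x ξ) ∂P.tilted Z - ∫ ξ, φ (G y ξ) ∂P.tilted Z' ≤
          L * D * ((1 + β * ω x) + (1 + β * ω y)) := by
  obtain ⟨b', hb', C, hdrift⟩ := hG.exists_tilted_drift hκ
  obtain ⟨R, hR, hCR⟩ : ∃ R > 0, 2 * C < (1 - b') * R := by
    have hb'' := sub_pos.mpr hb'
    refine ⟨(2 * |C| + 1) / (1 - b'), by positivity, ?_⟩
    rw [mul_div_cancel₀ _ hb''.ne']
    linarith [le_abs_self C]
  obtain ⟨α, hα, hoverlap⟩ := hG.exists_tilted_overlap hκ hR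
  obtain ⟨β, hβ, L, hL, hcontr⟩ := exists_contraction_of_drift_of_overlap (C := C)
    hG.continuous_weight.measurable hG.weight_nonneg hb' hα hR hCR
  have hmeas := hG.measurable_apply
  have hprob : ∀ x Z, AEMeasurable Z P → OscLE (fun ξ => 1 + ω x + a ξ) κ Z →
      IsProbabilityMeasure ((P.tilted Z).map (G x)) := fun x Z hZ hosc =>
    have := hG.isProbabilityMeasure_tilted hZ hosc
    Measure.isProbabilityMeasure_map (hmeas x).aemeasurable
  have hmap : ∀ x Z {φ : E → ℝ}, Measurable φ →
      ∫ z, φ z ∂(P.tilted Z).map (G x) = ∫ ξ, φ (G x ξ) ∂P.tilted Z := fun x Z φ hφ =>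
    integral_map (hmeas x).aemeasurable hφ.aestronglyMeasurable
  have hint : ∀ x Z, AEMeasurable Z P → OscLE (fun ξ => 1 + ω x + a ξ) κ Z →
      Integrable ω ((P.tilted Z).map (G x)) := fun x Z hZ hosc =>
    (integrable_map_measure hG.continuous_weight.measurable.aestronglyMeasurable
      (hmeas x).aemeasurable).mpr (hG.integrable_weight_tilted hZ hosc)
  refine ⟨β, hβ, L, hL, fun x y Z Z' hZ hZ' hosc hosc' D φ hφ hφD => ?_⟩
  rw [← hmap x Z hφ, ← hmap y Z' hφ]
  refine hcontr _ _ (ω x) (ω y) (hprob x Z hZ hosc) (hprob y Z' hZ' hosc') (hG.weight_nonneg x)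
    (hG.weight_nonneg y) (hint x Z hZ hosc) (hint y Z' hZ' hosc') ?_ ?_ (fun hxy => ?_) D φ hφ hφD
  · exact (hmap x Z hG.continuous_weight.measurable).trans_le (hdrift x Z hZ hosc)
  · exact (hmap y Z' hG.continuous_weight.measurable).trans_le (hdrift y Z' hZ' hosc')
  · exact hoverlap x y Z Z' hZ hZ' hosc hosc' (by linarith [hG.weight_nonneg y])
      (by linarith [hG.weight_nonneg x])

end LyapunovTransition

end TiltedTransitions

section Bellman

variable {E A Ω : Type*} [MeasurableSpace Ω] {P : Measure Ω} {G : E → Ω → E} {ω : E → ℝ}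
  {a : Ω → ℝ} {b ρ ρ' M M' s : ℝ} {r : E → A → Ω → ℝ} {f g u u' : E → ℝ}

/-- The exponent under the expectation in the Bellman operator: the running reward `r` of the
control `h` in the state `x`, plus the continuation value `f` of the next state. -/
def payoff (G : E → Ω → E) (r : E → A → Ω → ℝ) (f : E → ℝ) (x : E) (h : A) (ξ : Ω) : ℝ :=
  r x h ξ + f (G x ξ)

/-- The risk-sensitive Bellman operator with real values, the counterpart of `bellmanOp`. -/
noncomputable def bellmanValue (P : Measure Ω) (G : E → Ω → E) (r : E → A → Ω → ℝ) (f : E → ℝ)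
    (x : E) : ℝ :=
  ⨅ h, logMeanExp P (payoff G r f x h)

/-- `r x h ξ`, the reward of the control `h` in the state `x` under the noise `ξ`, is dominated by
`ρ` times the weight `1 + ω x + a ξ`. -/
structure WeightedReward [TopologicalSpace E] [TopologicalSpace A] (ω : E → ℝ) (a : Ω → ℝ) (ρ : ℝ)
    (r : E → A → Ω → ℝ) : Prop where
  measurable_apply : ∀ x h, Measurable (r x h)
  continuous_apply : ∀ ξ, Continuous fun p : E × A => r p.1 p.2 ξ
  abs_le : ∀ x h ξ, |r x h ξ| ≤ ρ * (1 + ω x + a ξ)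

variable [TopologicalSpace E] [MeasurableSpace E] [TopologicalSpace A]

namespace LyapunovTransition

lemma measurable_payoff (hG : LyapunovTransition P G ω a b) (hr : WeightedReward ω a ρ r)
    (hf : Measurable f) (x : E) (h : A) : Measurable (payoff G r f x h) :=
  (hr.measurable_apply x h).add (hf.comp (hG.measurable_apply x))

lemma one_add_weight_pos (hG : LyapunovTransition P G ω a b) (x : E) : 0 < 1 + ω x :=
  add_pos_of_pos_of_nonneg one_pos (hG.weight_nonneg x)

lemma weightedReward_mono (hG : LyapunovTransition P G ω a b) (hr : WeightedReward ω a ρ r)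
    (hρ : ρ ≤ ρ') : WeightedReward ω a ρ' r where
  measurable_apply := hr.measurable_apply
  continuous_apply := hr.continuous_apply
  abs_le x h ξ := (hr.abs_le x h ξ).trans <| mul_le_mul_of_nonneg_right hρ <|
    (hG.one_add_weight_pos (G x ξ)).le.trans (hG.weight_apply_le x ξ)

lemma abs_payoff_sub_le (hG : LyapunovTransition P G ω a b) (hr : WeightedReward ω a ρ r)
    (hf : ∀ z, |f z - s| ≤ M * (1 + ω z)) (x : E) (h : A) (ξ : Ω) :
    |payoff G r f x h ξ - s| ≤ (ρ + M) * (1 + ω x + a ξ) := by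
  have hM : 0 ≤ M :=
    nonneg_of_mul_nonneg_left ((abs_nonneg _).trans (hf x)) (hG.one_add_weight_pos x)
  calc |payoff G r f x h ξ - s| ≤ |r x h ξ| + |f (G x ξ) - s| := by
        rw [payoff, add_sub_assoc]
        exact abs_add_le _ _
    _ ≤ ρ * (1 + ω x + a ξ) + M * (1 + ω x + a ξ) := add_le_add (hr.abs_le x h ξ)
        ((hf _).trans (mul_le_mul_of_nonneg_left (hG.weight_apply_le x ξ) hM))
    _ = (ρ + M) * (1 + ω x + a ξ) := by ring

lemma oscLE_payoff (hG : LyapunovTransition P G ω a b) (hr : WeightedReward ω a ρ r)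
    (hf : OscLE (fun z => 1 + ω z) M f) (x : E) (h : A) :
    OscLE (fun ξ => 1 + ω x + a ξ) (ρ + M) (payoff G r f x h) := by
  have : Nonempty E := ⟨x⟩
  obtain ⟨s, hs⟩ := hf.exists_center
  exact .of_abs_sub_const_le (hG.abs_payoff_sub_le hr hs x h)

lemma integrable_exp_payoff (hG : LyapunovTransition P G ω a b) (hr : WeightedReward ω a ρ r)
    (hf : Measurable f) (hfM : OscLE (fun z => 1 + ω z) M f) (x : E) (h : A) :
    Integrable (fun ξ => exp (payoff G r f x h ξ)) P := by
  have : Nonempty E := ⟨x⟩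
  obtain ⟨s, hs⟩ := hfM.exists_center
  exact hG.expMoments.integrable_exp_of_abs_sub_le (hG.measurable_payoff hr hf x h).aemeasurable
    (hG.abs_payoff_sub_le hr hs x h)

variable [OpensMeasurableSpace E] [FirstCountableTopology E] [FirstCountableTopology A]
  [IsProbabilityMeasure P]

lemma continuous_logMeanExp_payoff (hG : LyapunovTransition P G ω a b)
    (hr : WeightedReward ω a ρ r) (hf : Continuous f) (hfM : OscLE (fun z => 1 + ω z) M f) :
    Continuous fun p : E × A => logMeanExp P (payoff G r f p.1 p.2) := by
  refine Continuous.log ?_ fun p =>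
    (integral_exp_pos (hG.integrable_exp_payoff hr hf.measurable hfM p.1 p.2)).ne'
  refine continuous_iff_continuousAt.mpr fun ⟨x₀, h₀⟩ => ?_
  have : Nonempty E := ⟨x₀⟩
  obtain ⟨s, hs⟩ := hfM.exists_center
  set κ := ρ + M
  have hnear : ∀ᶠ p : E × A in 𝓝 (x₀, h₀), κ * (1 + ω p.1) < κ * (1 + ω x₀) + 1 := by
    have hcont : Continuous fun p : E × A => κ * (1 + ω p.1) :=
      continuous_const.mul (continuous_const.add (hG.continuous_weight.comp continuous_fst))
    exact hcont.continuousAt.eventually_lt_const (lt_add_one _)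
  refine continuousAt_of_dominated
    (bound := fun ξ => exp (s + (κ * (1 + ω x₀) + 1) + κ * a ξ))
    (.of_forall fun p =>
      (hG.measurable_payoff hr hf.measurable p.1 p.2).exp.aestronglyMeasurable)
    (hnear.mono fun p hp => ae_of_all _ fun ξ => ?_)
    (hG.expMoments.integrable_exp_of_le
      ((hG.expMoments.aemeasurable.const_mul κ).const_add _) fun ξ => le_rfl)
    (ae_of_all _ fun ξ => ?_)
  · rw [norm_of_nonneg (exp_pos _).le, exp_le_exp]
    linarith [(abs_le.mp (hG.abs_payoff_sub_le hr hs p.1 p.2 ξ)).2]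
  · have hpayoff : Continuous fun p : E × A => payoff G r f p.1 p.2 ξ :=
      (hr.continuous_apply ξ).add (hf.comp ((hG.continuous_apply ξ).comp continuous_fst))
    exact hpayoff.rexp.continuousAt

variable [CompactSpace A]

lemma continuous_bellmanValue (hG : LyapunovTransition P G ω a b) (hr : WeightedReward ω a ρ r)
    (hf : Continuous f) (hfM : OscLE (fun z => 1 + ω z) M f) :
    Continuous (bellmanValue P G r f) := by
  have h := isCompact_univ.continuous_sInf (γ := E) (β := A)
    (f := fun x h => logMeanExp P (payoff G r f x h)) (hG.continuous_logMeanExp_payoff hr hf hfM)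
  simp only [Set.image_univ, sInf_range] at h
  exact h

variable [Nonempty A]

lemma isLeast_bellmanValue (hG : LyapunovTransition P G ω a b) (hr : WeightedReward ω a ρ r)
    (hf : Continuous f) (hfM : OscLE (fun z => 1 + ω z) M f) (x : E) :
    IsLeast (Set.range fun h => logMeanExp P (payoff G r f x h)) (bellmanValue P G r f x) := by
  have hcont : Continuous fun h : A => logMeanExp P (payoff G r f x h) :=
    (hG.continuous_logMeanExp_payoff hr hf hfM).comp (Continuous.prodMk_right x)
  exact (isCompact_range hcont).isLeast_sInf (Set.range_nonempty _)

lemma bellmanValue_add_const (hG : LyapunovTransition P G ω a b) (hr : WeightedReward ω a ρ r)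
    (hf : Continuous f) (hfM : OscLE (fun z => 1 + ω z) M f) (c : ℝ) (x : E) :
    bellmanValue P G r (fun z => f z + c) x = bellmanValue P G r f x + c := by
  have hpayoff : ∀ h, logMeanExp P (payoff G r (fun z => f z + c) x h) =
      logMeanExp P (payoff G r f x h) + c := fun h => by
    rw [← logMeanExp_add_const (hG.integrable_exp_payoff hr hf.measurable hfM x h)]
    exact congrArg (logMeanExp P) (funext fun ξ => (add_assoc _ _ _).symm)
  simp only [bellmanValue, hpayoff]
  exact (ciInf_add (hG.isLeast_bellmanValue hr hf hfM x).bddBelow c).symm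

lemma oscLE_bellmanValue (hG : LyapunovTransition P G ω a b) (hr : WeightedReward ω a ρ r)
    (hf : Continuous f) (hfM : OscLE (fun z => 1 + ω z) M f) :
    OscLE (fun z => 1 + ω z) (ρ + M + |cgf a P (ρ + M)|) (bellmanValue P G r f) := by
  rcases isEmpty_or_nonempty E with hE | hE
  · exact fun x => hE.elim x
  obtain ⟨s, hs⟩ := hfM.exists_center
  refine .of_abs_sub_const_le (s := s) fun x => ?_
  obtain ⟨h, hh⟩ := (hG.isLeast_bellmanValue hr hf hfM x).1
  have hcgf : cgf a P (ρ + M) ≤ |cgf a P (ρ + M)| * (1 + ω x) :=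
    (le_abs_self _).trans (le_mul_of_one_le_right (abs_nonneg _)
      (le_add_of_nonneg_right (hG.weight_nonneg x)))
  rw [← hh]
  linarith [hG.expMoments.abs_logMeanExp_sub_le
    (hG.measurable_payoff hr hf.measurable x h).aemeasurable (hG.abs_payoff_sub_le hr hs x h)]

lemma exists_bellmanValue_sub_le (hG : LyapunovTransition P G ω a b)
    (hr : WeightedReward ω a ρ r) (hM : 0 ≤ M) (hf : Continuous f) (hg : Continuous g)
    (hfM : OscLE (fun z => 1 + ω z) M f) (hgM : OscLE (fun z => 1 + ω z) M g) (x : E) :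
    ∃ h, bellmanValue P G r f x - bellmanValue P G r g x ≤
      ∫ ξ, (f - g) (G x ξ) ∂P.tilted (payoff G r f x h) := by
  obtain ⟨h, hh⟩ := (hG.isLeast_bellmanValue hr hg hgM x).1
  have hfh := (hG.isLeast_bellmanValue hr hf hfM x).2 (Set.mem_range_self h)
  have hZ := (hG.measurable_payoff hr hf.measurable x h).aemeasurable (μ := P)
  have hosc := hG.oscLE_payoff hr hfM x h
  have hadd : payoff G r f x h + (fun ξ => (g - f) (G x ξ)) = payoff G r g x h := by
    ext ξ
    simp only [payoff, Pi.add_apply, Pi.sub_apply]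
    ring
  have hsub := integral_tilted_le_logMeanExp_sub (Y := fun ξ => (g - f) (G x ξ))
    (hG.integrable_exp_payoff hr hf.measurable hfM x h)
    ((hG.integrable_exp_payoff hr hg.measurable hgM x h).congr
      (.of_forall fun ξ => congrArg exp (congrFun hadd ξ).symm))
    ((hG.integrable_comp_tilted hZ hosc hM hg.measurable hgM).sub
      (hG.integrable_comp_tilted hZ hosc hM hf.measurable hfM))
  refine ⟨h, ?_⟩
  rw [hadd] at hsub
  rw [← neg_sub g f]
  simp only [Pi.neg_apply, integral_neg] at hsub hh hfh ⊢
  linarith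

theorem exists_isLocalOscContraction_bellmanValue (hG : LyapunovTransition P G ω a b)
    (hρ : 0 ≤ ρ) (hM : 0 ≤ M) :
    ∃ β ∈ Set.Ioo (0 : ℝ) 1, ∃ L ∈ Set.Ioo (0 : ℝ) 1, ∀ r : E → A → Ω → ℝ,
      WeightedReward ω a ρ r → IsLocalOscContraction (fun z => 1 + ω z) M
        (fun z => 1 + β * ω z) L (bellmanValue P G r) := by
  obtain ⟨β, hβ, L, hL, hcontr⟩ := hG.exists_tilted_contraction (add_nonneg hρ hM)
  refine ⟨β, hβ, L, hL, fun r hr f g hf hg hfM hgM D hD x y => ?_⟩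
  obtain ⟨h, hfg⟩ := hG.exists_bellmanValue_sub_le hr hM hf hg hfM hgM x
  obtain ⟨h', hgf⟩ := hG.exists_bellmanValue_sub_le hr hM hg hf hgM hfM y
  have hcontr_xy := hcontr x y _ _ (hG.measurable_payoff hr hf.measurable x h).aemeasurable
    (hG.measurable_payoff hr hg.measurable y h').aemeasurable (hG.oscLE_payoff hr hfM x h)
    (hG.oscLE_payoff hr hgM y h') D (f - g) (hf.sub hg).measurable hD
  rw [← neg_sub f g] at hgf
  simp only [Pi.neg_apply, integral_neg] at hgf
  simp only [Pi.sub_apply (f := bellmanValue P G r f)]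
  linarith

theorem exists_fixedPoint_bellmanValue [Nonempty E] (hG : LyapunovTransition P G ω a b) :
    ∃ ρ > 0, ∀ r : E → A → Ω → ℝ, WeightedReward ω a ρ r → ∃ u c, Continuous u ∧
      OscLE (fun z => 1 + ω z) 1 u ∧ ∀ x, bellmanValue P G r u x = u x + c := by
  have hω := hG.weight_nonneg
  obtain ⟨β, hβ, L, hL, hcontr⟩ :=
    hG.exists_isLocalOscContraction_bellmanValue (A := A) zero_le_one zero_le_one
  have hL1 : 0 < 1 - L := sub_pos.mpr hL.2
  obtain ⟨ρ, hρ, hρL⟩ := hG.expMoments.exists_pos_add_abs_cgf_le (mul_pos hL1 hβ.1)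
  refine ⟨ρ, hρ.1, fun r hr => ?_⟩
  have hweight : ∀ z, 1 + β * ω z ≤ 1 + ω z := fun z => by
    linarith [mul_le_of_le_one_left (hω z) hβ.2.le]
  have hunit : ∀ f, OscLE (fun z => 1 + β * ω z) 1 f → OscLE (fun z => 1 + ω z) 1 f :=
    fun f hf => hf.mono_weight zero_le_one hweight
  have hT : IsLocalOscContraction (fun z => 1 + β * ω z) 1 (fun z => 1 + β * ω z) L
      (bellmanValue P G r) := fun f g hf hg hf1 hg1 =>
    hcontr r (hG.weightedReward_mono hr hρ.2) f g hf hg (hunit f hf1) (hunit g hg1)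
  have hzero : OscLE (fun z => 1 + β * ω z) ((1 - L) * 1) (bellmanValue P G r 0) := by
    have h := hG.oscLE_bellmanValue hr (M := 0) continuous_zero fun x y => by simp
    rw [add_zero] at h
    rw [mul_one, ← mul_div_cancel_right₀ (1 - L) hβ.1.ne']
    exact (h.mono (fun z => (hG.one_add_weight_pos z).le) hρL).one_add_mul hω ⟨hβ.1, hβ.2.le⟩
  obtain ⟨u, c, hu, hu1, hfix⟩ := hT.exists_fixedPoint_mod_const
    (continuous_const.add (continuous_const.mul hG.continuous_weight))
    (fun z => add_nonneg zero_le_one (mul_nonneg hβ.1.le (hω z))) ⟨hL.1.le, hL.2⟩ zero_le_one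
    (fun f hf hf1 => hG.continuous_bellmanValue hr hf (hunit f hf1)) hzero
  exact ⟨u, c, hu, hunit u hu1, hfix⟩

theorem fixedPoint_bellmanValue_unique [Nonempty E] (hG : LyapunovTransition P G ω a b)
    (hρ : 0 ≤ ρ) (hr : WeightedReward ω a ρ r) {c c' : ℝ} (hu : Continuous u)
    (hu' : Continuous u') (huM : OscLE (fun z => 1 + ω z) M u)
    (huM' : OscLE (fun z => 1 + ω z) M' u') (hfix : ∀ x, bellmanValue P G r u x = u x + c)
    (hfix' : ∀ x, bellmanValue P G r u' x = u' x + c') :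
    c' = c ∧ ∃ d, ∀ x, u' x = u x + d := by
  have hw := hG.one_add_weight_pos
  have hmax := huM.mono (fun z => (hw z).le) (le_max_left M M')
  have hmax' := huM'.mono (fun z => (hw z).le) (le_max_right M M')
  obtain ⟨β, hβ, L, hL, hcontr⟩ :=
    hG.exists_isLocalOscContraction_bellmanValue (A := A) hρ (hmax.nonneg hw)
  obtain ⟨z⟩ := ‹Nonempty E›
  have hconst : ∀ x, u' x = u x + (u' z - u z) := fun x => by
    have h := (hcontr r hr).sub_eq_of_fixedPoint_mod_const ⟨hL.1.le, hL.2⟩ hu hu' hmax hmax'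
      ((huM'.sub huM).one_add_mul hG.weight_nonneg ⟨hβ.1, hβ.2.le⟩) hfix hfix' x z
    simp only [Pi.sub_apply] at h
    linarith
  refine ⟨?_, _, hconst⟩
  have hshift := hG.bellmanValue_add_const hr hu huM (u' z - u z) z
  rw [← funext hconst, hfix', hfix] at hshift
  linarith [hconst z]

end LyapunovTransition

end Bellman

section WeightedSpan

variable {k : ℕ} {ω f g : Vec k → ℝ} {β D : ℝ}

lemma memCω_iff (hω : ∀ x, 0 ≤ ω x) :
    MemCω ω f ↔ Continuous f ∧ ∃ M, OscLE (fun x => 1 + ω x) M f := by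
  have hpos : ∀ x, 0 < 1 + ω x := fun x => add_pos_of_pos_of_nonneg one_pos (hω x)
  refine and_congr_right fun _ => ⟨fun ⟨M, hM⟩ => ⟨M, ?_⟩, fun ⟨M, hM⟩ => ?_⟩
  · refine .of_abs_sub_const_le (s := 0) fun x => ?_
    rw [sub_zero]
    exact (div_le_iff₀ (hpos x)).mp (hM ⟨x, rfl⟩)
  · obtain ⟨s, hs⟩ := hM.exists_center
    refine ⟨M + |s|, Set.forall_mem_range.mpr fun x => (div_le_iff₀ (hpos x)).mpr ?_⟩
    have hle : |s| ≤ |s| * (1 + ω x) :=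
      le_mul_of_one_le_right (abs_nonneg s) (le_add_of_nonneg_right (hω x))
    linarith [hs x, abs_sub_abs_le_abs_sub (f x) s]

lemma MemCω.sub (hω : ∀ x, 0 ≤ ω x) (hf : MemCω ω f) (hg : MemCω ω g) : MemCω ω (f - g) := by
  rw [memCω_iff hω] at *
  obtain ⟨hf, M, hfM⟩ := hf
  obtain ⟨hg, M', hgM⟩ := hg
  exact ⟨hf.sub hg, M + M', hfM.sub hgM⟩

lemma MemCω.spanSeminorm_le_iff (hω : ∀ x, 0 ≤ ω x) (hf : MemCω ω f)
    (hβ : β ∈ Set.Ioc (0 : ℝ) 1) :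
    spanSeminorm β ω f ≤ D ↔ OscLE (fun x => 1 + β * ω x) D f := by
  have hden : ∀ x y, (1 + β * ω x) + (1 + β * ω y) = 2 + β * ω x + β * ω y :=
    fun x y => by ring
  have hpos : ∀ x y, 0 < 2 + β * ω x + β * ω y := fun x y => by
    linarith [mul_nonneg hβ.1.le (hω x), mul_nonneg hβ.1.le (hω y)]
  have hiff : ∀ D, OscLE (fun x => 1 + β * ω x) D f ↔
      ∀ p : Vec k × Vec k, (f p.1 - f p.2) / (2 + β * ω p.1 + β * ω p.2) ≤ D := fun D => by
    simp only [OscLE, Prod.forall, div_le_iff₀ (hpos _ _), hden]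
  obtain ⟨M, hM⟩ := ((memCω_iff hω).mp hf).2
  exact (ciSup_le_iff ⟨M / β, Set.forall_mem_range.mpr ((hiff _).mp (hM.one_add_mul hω hβ))⟩).trans
    (hiff D).symm

lemma IsLocalOscContraction.spanSeminorm_le {T : (Vec k → ℝ) → Vec k → ℝ} {M L : ℝ}
    (hT : IsLocalOscContraction (fun x => 1 + ω x) M (fun x => 1 + β * ω x) L T)
    (hω : ∀ x, 0 ≤ ω x) (hβ : β ∈ Set.Ioc (0 : ℝ) 1) (hf : MemCω ω f) (hg : MemCω ω g)
    (hTf : MemCω ω (T f)) (hTg : MemCω ω (T g)) (hfM : spanSeminorm 1 ω f ≤ M)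
    (hgM : spanSeminorm 1 ω g ≤ M) :
    spanSeminorm β ω (T f - T g) ≤ L * spanSeminorm β ω (f - g) := by
  have hone : (1 : ℝ) ∈ Set.Ioc (0 : ℝ) 1 := ⟨one_pos, le_rfl⟩
  rw [hf.spanSeminorm_le_iff hω hone] at hfM
  rw [hg.spanSeminorm_le_iff hω hone] at hgM
  simp only [one_mul] at hfM hgM
  exact ((hTf.sub hω hTg).spanSeminorm_le_iff hω hβ).mpr <| hT f g hf.1 hg.1 hfM hgM _ <|
    ((hf.sub hω hg).spanSeminorm_le_iff hω hβ).mp le_rfl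

end WeightedSpan

section Assumptions

variable {Ω : Type*} [MeasurableSpace Ω] {P : Measure Ω}

lemma logExpMoment_eq_coe_logMeanExp [NeZero P] {Z : Ω → ℝ}
    (hZ : Integrable (fun ξ => exp (Z ξ)) P) :
    logExpMoment P Z = logMeanExp P Z := by
  rw [logExpMoment, ← ofReal_integral_eq_lintegral_ofReal hZ (ae_of_all _ fun _ => (exp_pos _).le),
    ENNReal.log_ofReal_of_pos (integral_exp_pos hZ), logMeanExp]

lemma hasExpMoments_of_entropicUtility [IsFiniteMeasure P] {a : Ω → ℝ} (ha : Measurable a)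
    (hfin : ∀ γ, ∃ r : ℝ, entropicUtility P γ a = r) : HasExpMoments P a := by
  intro γ
  rcases eq_or_ne γ 0 with rfl | hγ
  · simp
  refine ⟨by fun_prop, ?_⟩
  rw [hasFiniteIntegral_iff_ofReal (ae_of_all _ fun _ => (exp_pos _).le), lt_top_iff_ne_top]
  intro htop
  obtain ⟨r, hr⟩ := hfin γ
  rw [entropicUtility, if_neg hγ, logExpMoment, htop, ENNReal.log_top] at hr
  rcases (one_div_ne_zero hγ).lt_or_gt with hneg | hpos
  · exact EReal.coe_ne_bot r (hr.symm.trans (EReal.coe_mul_top_of_neg hneg))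
  · exact EReal.coe_ne_top r (hr.symm.trans (EReal.coe_mul_top_of_pos hpos))

variable {k m d : ℕ} {W : ℕ → Ω → Vec d} {G : Vec k → Vec d → Vec k} {U : Set (Vec m)}
  {F : Vec k → U → Vec d → ℝ} {ω : Vec k → ℝ} {a₁ a₂ : Vec d → ℝ} {b₁ b₂ : ℝ}

lemma GrowthAssumption.weightedReward (hgrowth : GrowthAssumption P W G F ω a₁ a₂ b₁ b₂)
    (hW : Measurable (W 0))
    (hFm : Measurable fun p : Vec k × U × Vec d => F p.1 p.2.1 p.2.2)
    (hFc : ∀ w, Continuous fun p : Vec k × U => F p.1 p.2 w) (γ : ℝ) :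
    WeightedReward ω (fun ξ => a₁ (W 0 ξ) + a₂ (W 0 ξ)) (|γ| * (1 + b₂))
      (fun x h ξ => γ * F x h (W 0 ξ)) where
  measurable_apply x h :=
    (hFm.comp (measurable_const.prodMk (measurable_const.prodMk hW))).const_mul γ
  continuous_apply ξ := (hFc (W 0 ξ)).const_mul γ
  abs_le x h ξ := by
    have ha₁ := hgrowth.nonneg_a₁ (W 0 ξ)
    have ha₂ := hgrowth.nonneg_a₂ (W 0 ξ)
    have hω := hgrowth.nonneg_ω x
    have hb₂ := hgrowth.b₂_pos
    rw [abs_mul, mul_assoc]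
    refine mul_le_mul_of_nonneg_left ((hgrowth.growth_F x h (W 0 ξ)).trans ?_) (abs_nonneg γ)
    linarith [mul_nonneg hb₂.le ha₁, mul_nonneg hb₂.le ha₂]

variable [IsProbabilityMeasure P]

lemma GrowthAssumption.lyapunovTransition (hgrowth : GrowthAssumption P W G F ω a₁ a₂ b₁ b₂)
    (hmin : MinorizationAssumption P W G ω) (hW : Measurable (W 0))
    (hGm : Measurable fun p : Vec k × Vec d => G p.1 p.2)
    (hGc : ∀ w, Continuous fun x => G x w) :
    LyapunovTransition P (fun x ξ => G x (W 0 ξ)) ω (fun ξ => a₁ (W 0 ξ) + a₂ (W 0 ξ)) b₁ where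
  measurable_apply x := hGm.comp (measurable_const.prodMk hW)
  continuous_apply ξ := hGc (W 0 ξ)
  continuous_weight := hgrowth.continuous_ω
  weight_nonneg := hgrowth.nonneg_ω
  expMoments :=
    (hasExpMoments_of_entropicUtility (hgrowth.measurable_a₁.comp hW) hgrowth.finite_a₁).add
      (hasExpMoments_of_entropicUtility (hgrowth.measurable_a₂.comp hW) hgrowth.finite_a₂)
  rate_lt_one := hgrowth.b₁_mem.2
  weight_le x ξ := by linarith [hgrowth.growth_G x (W 0 ξ), hgrowth.nonneg_a₂ (W 0 ξ)]
  minorization R hR := by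
    obtain ⟨c, hc, ν, hν, hle⟩ := hmin R hR
    refine ⟨c, hc, ν, hν, fun B hB x hx => ?_⟩
    have h := ENNReal.toReal_mono (measure_ne_top P _) (hle B hB x hx)
    rwa [ENNReal.toReal_mul, ENNReal.toReal_ofReal hc.le] at h

lemma bellmanOp_eq_coe_bellmanValue [CompactSpace U] [Nonempty U] {a : Ω → ℝ} {b ρ γ : ℝ}
    (hG : LyapunovTransition P (fun x ξ => G x (W 0 ξ)) ω a b)
    (hr : WeightedReward ω a ρ fun x (h : U) ξ => γ * F x h (W 0 ξ)) {f : Vec k → ℝ}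
    (hf : MemCω ω f) (x : Vec k) :
    bellmanOp P W G F γ f x =
      bellmanValue P (fun x ξ => G x (W 0 ξ)) (fun x (h : U) ξ => γ * F x h (W 0 ξ)) f x := by
  obtain ⟨hfc, M, hfM⟩ := (memCω_iff hG.weight_nonneg).mp hf
  have hleast := EReal.coe_strictMono.monotone.map_isLeast (hG.isLeast_bellmanValue hr hfc hfM x)
  rw [← Set.range_comp] at hleast
  rw [← hleast.isGLB.iInf_eq]
  exact iInf_congr fun h =>
    logExpMoment_eq_coe_logMeanExp (hG.integrable_exp_payoff hr hfc.measurable hfM x h)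

lemma MemCω.bellmanValue {A : Type*} [TopologicalSpace A] [FirstCountableTopology A]
    [CompactSpace A] [Nonempty A] {G : Vec k → Ω → Vec k} {r : Vec k → A → Ω → ℝ} {a : Ω → ℝ}
    {b ρ : ℝ} (hG : LyapunovTransition P G ω a b) (hr : WeightedReward ω a ρ r) {f : Vec k → ℝ}
    (hf : MemCω ω f) : MemCω ω (bellmanValue P G r f) := by
  rw [memCω_iff hG.weight_nonneg] at *
  obtain ⟨hfc, M, hfM⟩ := hf
  exact ⟨hG.continuous_bellmanValue hr hfc hfM, _, hG.oscLE_bellmanValue hr hfc hfM⟩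

end Assumptions

end RiskSensitive

open RiskSensitive in
theorem mainTheorem2_general {Ω : Type*} [MeasurableSpace Ω] (P : Measure Ω)
    [IsProbabilityMeasure P] {k m d : ℕ} {W : ℕ → Ω → Vec d} {G : Vec k → Vec d → Vec k}
    {U : Set (Vec m)} (hU : IsCompact U) (hU_ne : U.Nonempty) {F : Vec k → U → Vec d → ℝ}
    {ω : Vec k → ℝ} {a₁ a₂ : Vec d → ℝ} {b₁ b₂ : ℝ} (hW : Measurable (W 0))
    (hGm : Measurable fun p : Vec k × Vec d => G p.1 p.2) (hGc : ∀ w, Continuous fun x => G x w)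
    (hFm : Measurable fun p : Vec k × U × Vec d => F p.1 p.2.1 p.2.2)
    (hFc : ∀ w, Continuous fun p : Vec k × U => F p.1 p.2 w)
    (hgrowth : GrowthAssumption P W G F ω a₁ a₂ b₁ b₂) (hmin : MinorizationAssumption P W G ω) :
    ∃ γ₀ : ℝ, 0 < γ₀ ∧ ∃ β L : ℝ≥0 → Set.Ioo (0 : ℝ) 1, ∀ γ : ℝ, γ ≠ 0 → |γ| ≤ γ₀ →
      (∀ f, MemCω ω f → ∃ g, MemCω ω g ∧ ∀ x, bellmanOp P W G F γ f x = (g x : EReal)) ∧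
      (∀ (M : ℝ≥0) (f₁ f₂ g₁ g₂ : Vec k → ℝ), MemCω ω f₁ → MemCω ω f₂ →
        (∀ x, bellmanOp P W G F γ f₁ x = (g₁ x : EReal)) →
        (∀ x, bellmanOp P W G F γ f₂ x = (g₂ x : EReal)) →
        spanSeminorm 1 ω f₁ ≤ M → spanSeminorm 1 ω f₂ ≤ M →
        spanSeminorm (β M) ω (g₁ - g₂) ≤ (L M : ℝ) * spanSeminorm (β M) ω (f₁ - f₂)) ∧
      ∃ (u : Vec k → ℝ) (lam : ℝ), MemCω ω u ∧
        (∀ x, ((u x + lam * γ : ℝ) : EReal) = bellmanOp P W G F γ u x) ∧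
        ∀ (u' : Vec k → ℝ) (lam' : ℝ), MemCω ω u' →
          (∀ x, ((u' x + lam' * γ : ℝ) : EReal) = bellmanOp P W G F γ u' x) →
          lam' = lam ∧ ∃ c : ℝ, ∀ x, u' x = u x + c := by
  have : CompactSpace U := isCompact_iff_compactSpace.mp hU
  have : Nonempty U := hU_ne.to_subtype
  have hG := hgrowth.lyapunovTransition hmin hW hGm hGc
  have hb₂ : 0 < 1 + b₂ := add_pos one_pos hgrowth.b₂_pos
  obtain ⟨ρ, hρ, hfixedPoint⟩ := hG.exists_fixedPoint_bellmanValue (A := U)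
  choose β hβ L hL hcontr using fun M : ℝ≥0 =>
    hG.exists_isLocalOscContraction_bellmanValue (A := U) hρ.le M.coe_nonneg
  refine ⟨ρ / (1 + b₂), by positivity, fun M => ⟨β M, hβ M⟩, fun M => ⟨L M, hL M⟩,
    fun γ hγ hγρ => ?_⟩
  have hr := hG.weightedReward_mono (hgrowth.weightedReward hW hFm hFc γ) ((le_div_iff₀ hb₂).mp hγρ)
  have hop : ∀ {f g : Vec k → ℝ}, MemCω ω f → ((∀ x, bellmanOp P W G F γ f x = (g x : EReal)) ↔
      bellmanValue P (fun x ξ => G x (W 0 ξ)) (fun x (h : U) ξ => γ * F x h (W 0 ξ)) f = g) :=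
    fun hf => by
    simp only [bellmanOp_eq_coe_bellmanValue hG hr hf, EReal.coe_eq_coe_iff, funext_iff]
  refine ⟨fun f hf => ⟨_, hf.bellmanValue hG hr, (hop hf).mpr rfl⟩, ?_, ?_⟩
  · intro M f₁ f₂ g₁ g₂ hf₁ hf₂ hg₁ hg₂ hM₁ hM₂
    rw [← (hop hf₁).mp hg₁, ← (hop hf₂).mp hg₂]
    exact (hcontr M _ hr).spanSeminorm_le hG.weight_nonneg ⟨(hβ M).1, (hβ M).2.le⟩ hf₁ hf₂
      (hf₁.bellmanValue hG hr) (hf₂.bellmanValue hG hr) hM₁ hM₂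
  · obtain ⟨u, c, hu, hu1, hfix⟩ := hfixedPoint _ hr
    have huω : MemCω ω u := (memCω_iff hG.weight_nonneg).mpr ⟨hu, 1, hu1⟩
    refine ⟨u, c / γ, huω, fun x => ?_, fun u' lam' hu'ω hu' => ?_⟩
    · rw [div_mul_cancel₀ _ hγ, (hop huω).mpr (funext hfix)]
    · obtain ⟨hu'c, M, hu'M⟩ := (memCω_iff hG.weight_nonneg).mp hu'ω
      have hfix' := (hop hu'ω).mp fun x => (hu' x).symm
      obtain ⟨hlam, hconst⟩ := hG.fixedPoint_bellmanValue_unique hρ.le hr hu hu'c hu1 hu'M hfix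
        (congrFun hfix')
      exact ⟨(eq_div_iff hγ).mpr hlam, hconst⟩

open RiskSensitive in
theorem mainTheorem2
    {Ω : Type*} [MeasurableSpace Ω] (P : Measure Ω) [IsProbabilityMeasure P]
    (k m : ℕ) (W : ℕ → Ω → Vec (k + m))
    (G : Vec k → Vec (k + m) → Vec k) (x₀ : Vec k) (X : ℕ → Ω → Vec k)
    (U : Set (Vec m)) (hU : IsCompact U) (hU_ne : U.Nonempty)
    (F : Vec k → U → Vec (k + m) → ℝ) (V₀ : ℝ) (V : (ℕ → Ω → U) → ℕ → Ω → ℝ)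
    (ω : Vec k → ℝ) (a₁ a₂ : Vec (k + m) → ℝ) (b₁ b₂ : ℝ)
    (hA1 : NoiseAssumption P W)
    (hA2 : FactorAssumption P W G x₀ X)
    (hA3 : PortfolioAssumption P W X U F V₀ V)
    (hA4 : GrowthAssumption P W G F ω a₁ a₂ b₁ b₂)
    (hA5 : MinorizationAssumption P W G ω) :
    ∃ γ₀ : ℝ, γ₀ < 0 ∧ ∃ β L : ℝ≥0 → Set.Ioo (0 : ℝ) 1, ∀ γ ∈ Set.Ioo γ₀ 0,
      -- the Bellman operator maps `C_ω` into itself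
      (∀ f, MemCω ω f → ∃ g, MemCω ω g ∧ ∀ x, bellmanOp P W G F γ f x = (g x : EReal)) ∧
      -- it is a local contraction for the weighted span seminorms
      (∀ (M : ℝ≥0) (f₁ f₂ g₁ g₂ : Vec k → ℝ), MemCω ω f₁ → MemCω ω f₂ →
        (∀ x, bellmanOp P W G F γ f₁ x = (g₁ x : EReal)) →
        (∀ x, bellmanOp P W G F γ f₂ x = (g₂ x : EReal)) →
        spanSeminorm 1 ω f₁ ≤ M → spanSeminorm 1 ω f₂ ≤ M →
        spanSeminorm (β M) ω (g₁ - g₂) ≤ (L M : ℝ) * spanSeminorm (β M) ω (f₁ - f₂)) ∧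
      -- the Bellman equation has a solution, unique up to an additive constant in `u`
      ∃ (u : Vec k → ℝ) (lam : ℝ), MemCω ω u ∧
        (∀ x, ((u x + lam * γ : ℝ) : EReal) = bellmanOp P W G F γ u x) ∧
        ∀ (u' : Vec k → ℝ) (lam' : ℝ), MemCω ω u' →
          (∀ x, ((u' x + lam' * γ : ℝ) : EReal) = bellmanOp P W G F γ u' x) →
          lam' = lam ∧ ∃ c : ℝ, ∀ x, u' x = u x + c := by
  obtain ⟨r, hr, β, L, h⟩ := mainTheorem2_general P hU hU_ne (hA1.measurable 0) hA2.measurable_G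
    hA2.continuous_G hA3.measurable_F hA3.continuous_F hA4 hA5
  exact ⟨-r, neg_lt_zero.mpr hr, β, L, fun γ hγ =>
    h γ hγ.2.ne (abs_le.mpr ⟨hγ.1.le, hγ.2.le.trans hr.le⟩)⟩
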